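/- **Formulas.** Fix a set $\mathcal A$ of propositional variables. Formulas are generated by $A,B ::= a \mid A\supset B\mid A\wedge B\mid \Box A\mid\Diamond A\mid\Diamond\bot$. Even ($\circ$) and odd ($\bullet$) polarized formulas are generated by $$A^\circ,B^\circ ::= a^\circ\mid A^\circ\otimes B^\circ\mid A^\bullet\multimap B^\circ\mid\Box A^\circ\mid\Diamond A^\circ,\qquad A^\bullet,B^\bullet ::= a^\bullet\mid A^\bullet\otimes B^\bullet\mid A^\circ\multimap B^\bullet\mid\Box A^\bullet\mid\Diamond A^\bullet\mid\Diamond\bot^\bullet .$$ Formula isomorphism $\sim$ is the congruence on polarized formulas generated by $A\otimes B\sim B\otimes A$, $A\otimes(B\otimes C)\sim(A\otimes B)\otimes C$ and $(A\otimes B)\multimap C\sim A\multimap(B\multimap C)$. The deep rules, for an arbitrary one-hole context $\Gamma\{\ \}$, are (premise $\to$ conclusion) $$\Gamma\{\Diamond\bot^\bullet\}\to\Gamma\{(\Diamond A)^\bullet\},\quad \Gamma\{A^\bullet\}\to\Gamma\{(A\otimes B)^\bullet\},\quad \Gamma\{A^\circ\}\to\Gamma\{(B\multimap A)^\circ\},\quad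 \Gamma\{(A\otimes A)^\bullet\}\to\Gamma\{A^\bullet\}.$$ Write $H'\vdash_{\downarrow}H$ if there is a derivation from $H'$ to $H$ with these rules, formulas being taken up to $\sim$. **Arenas.** Consider directed graphs with two kinds of edges $\to$ and $\rightsquigarrow$ and vertices labelled in $\mathcal A\cup\{\Box,\Diamond\}$. A root is a vertex without outgoing $\to$-edge. $G+H$ is disjoint union; $G\mathbin{-\!\triangleright}H$ (resp. $G\mathbin{\sim\!\triangleright}H$) is the disjoint union with, in addition, a $\to$-edge (resp. $\rightsquigarrow$-edge) from every root of $G$ to every root of $H$. The arena of a formula is given by $⟦a⟧=\bullet_a$, $⟦A\supset B⟧=⟦A⟧\mathbin{-\!\triangleright}⟦B⟧$, $⟦A\wedge B⟧=⟦A⟧+⟦B⟧$, $⟦\Diamond\bot⟧=\bullet_\Diamond$, $⟦\Box A⟧=\bullet_\Box\mathbin{\sim\!\triangleright}⟦A⟧$, $⟦\Diamond A⟧=\bullet_\Diamond\mathbin{\sim\!\triangleright}⟦A⟧$. For a polarized formula $H$, $⟦H⟧$ is the arena of the formula obtained by forgetting polarities and reading $\otimes,\multimap$ as $\wedge,\supset$.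 The depth $d(v)$ is the length of a longest $\to$-path from $v$ to a root. A meeting point of $v,w$ is a nearest common $\to^*$-descendant (a common descendant that is not reached by $\to^*$ from a different common descendant). The meeting depth of $v,w$ is the minimal depth of their meeting points, or $-1$ if there is none. Distinct vertices $v,w$ are conjunct, $v\frown w$, if their meeting depth is odd, and disjunct, $v\smile w$, if it is even. **Skew fibrations.** A modal arena homomorphism $f\colon\mathcal H\to\mathcal G$ is a map on vertices that preserves $\to$, $\rightsquigarrow$, depth and labels, and such that whenever $v\rightsquigarrow f(u)$ in $\mathcal G$ there is $w$ in $\mathcal H$ with $w\rightsquigarrow u$ and $f(w)=v$. It is an even skew fibration if it preserves $\frown$, and whenever $f(v)\frown w$ there is $u$ with $v\frown u$ and not $f(u)\frown w$. It is an odd skew fibration if the same holds with $\smile$ in place of $\frown$ (the empty map $\emptyset_{\mathcal G}$ is then an odd skew fibration). **Theorem.** (a) Let $H',H$ be polarized formulas, both even (resp. both odd). Then $H'\vdash_{\downarrow}H$ if and only if there is an even (resp. odd) skew fibration $⟦H'⟧\to⟦H⟧$. (b) Every even or odd skew fibration between arenas of formulas belongs to the smallest families of even and of odd maps such that: isomorphisms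 of arenas are even and odd; $\emptyset_{\mathcal G}$ is odd for every arena $\mathcal G$; if $f,g$ have the same parity $p$, then so does $f+g$; if $f$ has the parity opposite to $p$ and $g$ has parity $p$ and non-empty domain, then $f\mathbin{-\!\triangleright}g$ has parity $p$; if $g$ has parity $p$ and $v$ is a vertex labelled $\Box$ or $\Diamond$, then $\mathrm{id}_v\mathbin{\sim\!\triangleright}g$ has parity $p$; if $f,g$ are odd with the same codomain, then the copairing $[f,g]$ on the disjoint union of their domains is odd; and the composite, through an arena, of two maps of parity $p$ has parity $p$. (Here "arena" means a graph isomorphic to the arena of a formula.) -/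

import Mathlib

/-- The two polarities: `even` is the output polarity `∘`, `odd` is the input polarity `•`. -/
inductive Polarity
  | even
  | odd

def Polarity.flip : Polarity → Polarity
  | .even => .odd
  | .odd => .even

/-- Modal formulas over propositional variables in `α`; `diaBot` is the formula `◇⊥`. -/
inductive Formula (α : Type*)
  | atom (a : α)
  | imp (A B : Formula α)
  | and (A B : Formula α)
  | box (A : Formula α)
  | dia (A : Formula α)
  | diaBot

/-- Polarized formulas. The left-hand side of an implication has the opposite polarity, and
`◇⊥` is available in odd polarity only. -/
inductive PFormula (α : Type*) : Polarity → Type _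
  | atom {p : Polarity} (a : α) : PFormula α p
  | tensor {p : Polarity} (A B : PFormula α p) : PFormula α p
  | limp {p : Polarity} (A : PFormula α p.flip) (B : PFormula α p) : PFormula α p
  | box {p : Polarity} (A : PFormula α p) : PFormula α p
  | dia {p : Polarity} (A : PFormula α p) : PFormula α p
  | diaBot : PFormula α Polarity.odd

namespace PFormula

variable {α : Type*}

/-- The underlying formula: polarities are forgotten, `⊗` becomes `∧` and `⊸` becomes `⊃`. -/
def erase : {p : Polarity} → PFormula α p → Formula α
  | _, atom a => .atom a
  | _, tensor A B => .and A.erase B.erase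
  | _, limp A B => .imp A.erase B.erase
  | _, box A => .box A.erase
  | _, dia A => .dia A.erase
  | _, diaBot => .diaBot

/-- One-hole contexts: `Ctx α q p` is a polarized formula of polarity `p` in which one
subformula of polarity `q` has been replaced by a hole. -/
inductive Ctx (α : Type*) (q : Polarity) : Polarity → Type _
  | hole : Ctx α q q
  | tensorL {p : Polarity} (C : Ctx α q p) (B : PFormula α p) : Ctx α q p
  | tensorR {p : Polarity} (A : PFormula α p) (C : Ctx α q p) : Ctx α q p
  | limpL {p : Polarity} (C : Ctx α q p.flip) (B : PFormula α p) : Ctx α q p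
  | limpR {p : Polarity} (A : PFormula α p.flip) (C : Ctx α q p) : Ctx α q p
  | box {p : Polarity} (C : Ctx α q p) : Ctx α q p
  | dia {p : Polarity} (C : Ctx α q p) : Ctx α q p

/-- Plugging a formula into the hole of a context. -/
def Ctx.fill {q : Polarity} : {p : Polarity} → Ctx α q p → PFormula α q → PFormula α p
  | _, .hole, X => X
  | _, .tensorL C B, X => .tensor (C.fill X) B
  | _, .tensorR A C, X => .tensor A (C.fill X)
  | _, .limpL C B, X => .limp (C.fill X) B
  | _, .limpR A C, X => .limp A (C.fill X)
  | _, .box C, X => .box (C.fill X)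
  | _, .dia C, X => .dia (C.fill X)

/-- The weakening and contraction rules, `Rule premise conclusion`, without their context. -/
inductive Rule : {q : Polarity} → PFormula α q → PFormula α q → Prop
  | weakDia (A : PFormula α .odd) : Rule diaBot (dia A)
  | weakTensor (A B : PFormula α .odd) : Rule A (tensor A B)
  | weakLimp (A : PFormula α .even) (B : PFormula α .odd) :
      Rule A (limp (p := .even) B A)
  | contr (A : PFormula α .odd) : Rule (tensor A A) A

/-- One application of a deep rule, from the premise `H'` to the conclusion `H`. -/
def DeepStep {p : Polarity} (H' H : PFormula α p) : Prop :=
  ∃ (q : Polarity) (C : Ctx α q p) (A' A : PFormula α q),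
    Rule A' A ∧ H' = C.fill A' ∧ H = C.fill A

/-- The equations generating formula isomorphism. -/
inductive IsoRule : {q : Polarity} → PFormula α q → PFormula α q → Prop
  | comm {q : Polarity} (A B : PFormula α q) : IsoRule (tensor A B) (tensor B A)
  | assoc {q : Polarity} (A B C : PFormula α q) :
      IsoRule (tensor A (tensor B C)) (tensor (tensor A B) C)
  | curry {q : Polarity} (A B : PFormula α q.flip) (C : PFormula α q) :
      IsoRule (limp (tensor A B) C) (limp A (limp B C))

/-- Formula isomorphism: the congruence generated by the equations above. -/
def FormulaIso {p : Polarity} : PFormula α p → PFormula α p → Prop :=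
  Relation.EqvGen fun X Y =>
    ∃ (q : Polarity) (C : Ctx α q p) (A B : PFormula α q),
      IsoRule A B ∧ X = C.fill A ∧ Y = C.fill B

/-- There is a derivation from `H'` to `H` with the deep weakening and contraction rules, where
formulas are taken up to formula isomorphism. -/
def Derives {p : Polarity} : PFormula α p → PFormula α p → Prop :=
  Relation.ReflTransGen fun X Y => DeepStep X Y ∨ FormulaIso X Y

end PFormula

/-- The labels of vertices. -/
inductive Label (α : Type*)
  | atom (a : α)
  | box
  | dia

/-- Vertex-labelled directed graphs with two kinds of edges: `v ⟶ w` (`iedge`) and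
`v ⤳ w` (`medge`). -/
structure LGraph (α : Type*) where
  V : Type
  iedge : V → V → Prop
  medge : V → V → Prop
  lab : V → Label α

namespace LGraph

variable {α : Type*}

/-- `v` is a `⟶`-root: it has no outgoing `⟶`-edge. -/
def IsRoot (G : LGraph α) (v : G.V) : Prop := ∀ w, ¬ G.iedge v w

/-- The graph with one vertex, labelled `l`. -/
def single (l : Label α) : LGraph α where
  V := Unit
  iedge _ _ := False
  medge _ _ := False
  lab _ := l

/-- The disjoint union `G + H`. -/
def sum (G H : LGraph α) : LGraph α where
  V := G.V ⊕ H.V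
  iedge
    | .inl u, .inl v => G.iedge u v
    | .inr u, .inr v => H.iedge u v
    | _, _ => False
  medge
    | .inl u, .inl v => G.medge u v
    | .inr u, .inr v => H.medge u v
    | _, _ => False
  lab
    | .inl v => G.lab v
    | .inr v => H.lab v

/-- `G —▷ H`: the disjoint union with a `⟶`-edge from each root of `G` to each root of `H`. -/
def arrow (G H : LGraph α) : LGraph α where
  V := G.V ⊕ H.V
  iedge
    | .inl u, .inl v => G.iedge u v
    | .inr u, .inr v => H.iedge u v
    | .inl u, .inr v => G.IsRoot u ∧ H.IsRoot v
    | .inr _, .inl _ => False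
  medge
    | .inl u, .inl v => G.medge u v
    | .inr u, .inr v => H.medge u v
    | _, _ => False
  lab
    | .inl v => G.lab v
    | .inr v => H.lab v

/-- `G ∼▷ H`: the disjoint union with a `⤳`-edge from each root of `G` to each root of `H`. -/
def squig (G H : LGraph α) : LGraph α where
  V := G.V ⊕ H.V
  iedge
    | .inl u, .inl v => G.iedge u v
    | .inr u, .inr v => H.iedge u v
    | _, _ => False
  medge
    | .inl u, .inl v => G.medge u v
    | .inr u, .inr v => H.medge u v
    | .inl u, .inr v => G.IsRoot u ∧ H.IsRoot v
    | .inr _, .inl _ => False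
  lab
    | .inl v => G.lab v
    | .inr v => H.lab v

/-- Isomorphisms of labelled graphs. -/
structure IsIso {H G : LGraph α} (f : H.V → G.V) : Prop where
  bijective : Function.Bijective f
  iedge_iff : ∀ v w, G.iedge (f v) (f w) ↔ H.iedge v w
  medge_iff : ∀ v w, G.medge (f v) (f w) ↔ H.medge v w
  lab_eq : ∀ v, G.lab (f v) = H.lab v

/-- `v ⟶* w`. -/
def Reach (G : LGraph α) : G.V → G.V → Prop := Relation.ReflTransGen G.iedge

/-- There is a `⟶`-path of length `n` from `v` to `w`. -/
def PathLen (G : LGraph α) : ℕ → G.V → G.V → Prop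
  | 0, v, w => v = w
  | n + 1, v, w => ∃ u, G.iedge v u ∧ G.PathLen n u w

/-- The depth of `v`: the length of a longest `⟶`-path from `v` to a root. -/
noncomputable def depth (G : LGraph α) (v : G.V) : ℕ :=
  sSup {n | ∃ r, G.IsRoot r ∧ G.PathLen n v r}

/-- `u` is a meeting point of `v` and `w`: a nearest common `⟶*`-descendant, that is, one that
is not reached from another common descendant. -/
def IsMeetingPoint (G : LGraph α) (v w u : G.V) : Prop :=
  (G.Reach v u ∧ G.Reach w u) ∧
    ∀ u', G.Reach v u' → G.Reach w u' → G.Reach u' u → u' = u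

open Classical in
/-- The meeting depth: the least depth of a meeting point, or `-1` if there is none. -/
noncomputable def meetingDepth (G : LGraph α) (v w : G.V) : ℤ :=
  if ∃ u, G.IsMeetingPoint v w u then
    ((sInf {n | ∃ u, G.IsMeetingPoint v w u ∧ G.depth u = n} : ℕ) : ℤ)
  else -1

/-- Conjunct vertices: distinct, of odd meeting depth. -/
def Conj (G : LGraph α) (v w : G.V) : Prop := v ≠ w ∧ Odd (G.meetingDepth v w)

/-- Disjunct vertices: distinct, of even meeting depth. -/
def Disj (G : LGraph α) (v w : G.V) : Prop := v ≠ w ∧ Even (G.meetingDepth v w)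

/-- The relation that skew fibrations of a given parity preserve and lift: conjunctness for even
ones and disjunctness for odd ones. -/
def Rel (G : LGraph α) : Polarity → G.V → G.V → Prop
  | .even => G.Conj
  | .odd => G.Disj

/-- Modal arena homomorphisms. -/
structure IsModalHom {H G : LGraph α} (f : H.V → G.V) : Prop where
  iedge : ∀ v w, H.iedge v w → G.iedge (f v) (f w)
  medge : ∀ v w, H.medge v w → G.medge (f v) (f w)
  depth : ∀ v, H.depth v = G.depth (f v)
  lab : ∀ v, H.lab v = G.lab (f v)
  modal : ∀ (v : G.V) (u : H.V), G.medge v (f u) → ∃ w, H.medge w u ∧ f w = v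

/-- Skew fibrations of parity `p`. For `p = odd` the empty map satisfies all the clauses. -/
structure IsSkewFibration (p : Polarity) {H G : LGraph α} (f : H.V → G.V) : Prop
    extends IsModalHom f where
  preserves : ∀ v w, H.Rel p v w → G.Rel p (f v) (f w)
  lifting : ∀ (v : H.V) (w : G.V), G.Rel p (f v) w → ∃ u, H.Rel p v u ∧ ¬ G.Rel p (f u) w

end LGraph

/-- The modal arena of a formula. -/
def Formula.arena {α : Type*} : Formula α → LGraph α
  | .atom a => .single (.atom a)
  | .imp A B => A.arena.arrow B.arena
  | .and A B => A.arena.sum B.arena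
  | .box A => (LGraph.single .box).squig A.arena
  | .dia A => (LGraph.single .dia).squig A.arena
  | .diaBot => .single .dia

/-- The modal arena of a polarized formula. -/
def PFormula.arena {α : Type*} {p : Polarity} (H : PFormula α p) : LGraph α := H.erase.arena

namespace LGraph

variable {α : Type*}

/-- `G` is, up to isomorphism, the modal arena of a formula. -/
def IsArena (G : LGraph α) : Prop := ∃ (F : Formula α) (e : F.arena.V → G.V), IsIso e

/-- `f₁ + f₂`. -/
def sumMap {H₁ G₁ H₂ G₂ : LGraph α} (f₁ : H₁.V → G₁.V) (f₂ : H₂.V → G₂.V) :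
    (H₁.sum H₂).V → (G₁.sum G₂).V := Sum.map f₁ f₂

/-- `f₁ —▷ f₂`. -/
def arrowMap {H₁ G₁ H₂ G₂ : LGraph α} (f₁ : H₁.V → G₁.V) (f₂ : H₂.V → G₂.V) :
    (H₁.arrow H₂).V → (G₁.arrow G₂).V := Sum.map f₁ f₂

/-- `f₁ ∼▷ f₂`. -/
def squigMap {H₁ G₁ H₂ G₂ : LGraph α} (f₁ : H₁.V → G₁.V) (f₂ : H₂.V → G₂.V) :
    (H₁.squig H₂).V → (G₁.squig G₂).V := Sum.map f₁ f₂

/-- The copairing `[f₁, f₂]`. -/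
def copair {H₁ H₂ G : LGraph α} (f₁ : H₁.V → G.V) (f₂ : H₂.V → G.V) :
    (H₁.sum H₂).V → G.V := Sum.elim f₁ f₂

/-- The maps of parity `p` that are built from the basic ones. Identities appear as isomorphisms
because vertices are not named. -/
inductive Built : Polarity → {H G : LGraph α} → (H.V → G.V) → Prop
  | iso {p : Polarity} {H G : LGraph α} {f : H.V → G.V} (hH : H.IsArena) (hf : IsIso f) :
      Built p f
  | empty {H G : LGraph α} {f : H.V → G.V} (hH : IsEmpty H.V) (hG : G.IsArena) : Built .odd f
  | sum {p : Polarity} {H₁ G₁ H₂ G₂ : LGraph α} {f₁ : H₁.V → G₁.V} {f₂ : H₂.V → G₂.V}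
      (h₁ : Built p f₁) (h₂ : Built p f₂) : Built p (sumMap f₁ f₂)
  | arrow {p : Polarity} {H₁ G₁ H₂ G₂ : LGraph α} {f₁ : H₁.V → G₁.V} {f₂ : H₂.V → G₂.V}
      (h₁ : Built p.flip f₁) (h₂ : Built p f₂) (hne : Nonempty H₂.V) :
      Built p (arrowMap f₁ f₂)
  | squig {p : Polarity} {l : Label α} {H G : LGraph α} {f : H.V → G.V}
      (hl : l = .box ∨ l = .dia) (h : Built p f) :
      Built p (squigMap (H₁ := single l) (G₁ := single l) id f)
  | copair {H₁ H₂ G : LGraph α} {f₁ : H₁.V → G.V} {f₂ : H₂.V → G.V}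
      (h₁ : Built .odd f₁) (h₂ : Built .odd f₂) : Built .odd (copair f₁ f₂)
  | comp {p : Polarity} {H K G : LGraph α} {f : H.V → K.V} {g : K.V → G.V}
      (hK : K.IsArena) (hf : Built p f) (hg : Built p g) : Built p (g ∘ f)

end LGraph

/-!
A derivation induces a map between the vertices of the arenas. Call a set of pairwise conjunct
vertices (disjunct vertices, for odd parity) a clique: the maps of the rules send maximal cliques
onto maximal cliques, a property which passes to composites and implies the lifting condition of
skew fibrations.

Conversely, the image of a skew fibration is again the arena of a formula, reached from the target
by weakenings, so one may assume the map surjective and argue by induction on the number of vertices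
of its source. If the target is a conjunction, the preimages of its two summands are closed under
edges and split the source. If it is an implication, then so is the source, unless the source is an
odd conjunction, where a contraction splits the map. Vertices are linked by conjunctness within any
formula that is not an implication, so currying the antecedent of the source (even case) or of the
target (odd case) makes the map respect the two sides of the implications.
-/

namespace LGraph

section Grading

variable {α : Type*} {G H K : LGraph α} {d : G.V → ℕ} {v w u : G.V}

/-- `d` decreases by one along every `⟶`-edge and vanishes only at roots. Such a function exists
on every arena, and it is then equal to the depth. -/
structure IsGrading (G : LGraph α) (d : G.V → ℕ) : Prop where
  of_iedge : ∀ {v w}, G.iedge v w → d v = d w + 1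
  exists_iedge : ∀ {v}, d v ≠ 0 → ∃ w, G.iedge v w

theorem IsGrading.isRoot_iff (hd : G.IsGrading d) : G.IsRoot v ↔ d v = 0 := by
  refine ⟨fun hv => ?_, fun hv w hvw => ?_⟩
  · by_contra h
    obtain ⟨w, hvw⟩ := hd.exists_iedge h
    exact hv w hvw
  · have := hd.of_iedge hvw
    omega

theorem IsGrading.exists_pathLen_iff (hd : G.IsGrading d) {n : ℕ} :
    (∃ r, G.IsRoot r ∧ G.PathLen n v r) ↔ n = d v := by
  induction n generalizing v with
  | zero =>
    rw [eq_comm, ← hd.isRoot_iff]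
    exact ⟨fun ⟨_, hr, h⟩ => (h : v = _) ▸ hr, fun hv => ⟨v, hv, rfl⟩⟩
  | succ n ih =>
    constructor
    · rintro ⟨r, hr, u, hvu, hur⟩
      rw [hd.of_iedge hvu, ← ih.1 ⟨r, hr, hur⟩]
    · intro hn
      obtain ⟨u, hvu⟩ := hd.exists_iedge (v := v) (by omega)
      obtain ⟨r, hr, hur⟩ := ih.2 (by have := hd.of_iedge hvu; omega : n = d u)
      exact ⟨r, hr, u, hvu, hur⟩

theorem IsGrading.depth_eq (hd : G.IsGrading d) : G.depth = d := by
  funext v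
  simp only [depth, hd.exists_pathLen_iff, Set.ofPred_eq_eq_singleton, csSup_singleton]

/-- Graphs in which the depth is a grading. -/
class Graded (G : LGraph α) : Prop where
  isGrading_depth : G.IsGrading G.depth

theorem IsGrading.graded (hd : G.IsGrading d) : G.Graded := ⟨hd.depth_eq ▸ hd⟩

theorem depth_of_iedge [hG : G.Graded] (h : G.iedge v w) : G.depth v = G.depth w + 1 :=
  hG.isGrading_depth.of_iedge h

theorem isRoot_iff_depth_eq_zero [hG : G.Graded] : G.IsRoot v ↔ G.depth v = 0 :=
  hG.isGrading_depth.isRoot_iff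

theorem exists_reach_isRoot [hG : G.Graded] (v : G.V) : ∃ r, G.IsRoot r ∧ G.Reach v r := by
  induction h : G.depth v generalizing v with
  | zero => exact ⟨v, isRoot_iff_depth_eq_zero.2 h, .refl⟩
  | succ n ih =>
    obtain ⟨w, hvw⟩ := hG.isGrading_depth.exists_iedge (v := v) (by omega)
    obtain ⟨r, hr, hwr⟩ := ih w (by have := depth_of_iedge hvw; omega)
    exact ⟨r, hr, .head hvw hwr⟩

theorem exists_isRoot (G : LGraph α) [G.Graded] [Nonempty G.V] : ∃ r, G.IsRoot r :=
  (exists_reach_isRoot (Classical.arbitrary G.V)).imp fun _ => And.left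

theorem IsRoot.eq_of_reach (hv : G.IsRoot v) (h : G.Reach v w) : v = w :=
  h.cases_head.resolve_right fun ⟨u, hvu, _⟩ => hv u hvu

theorem Reach.depth_le [G.Graded] (h : G.Reach v w) : G.depth w ≤ G.depth v := by
  induction h with
  | refl => exact le_rfl
  | tail _ h ih => have := depth_of_iedge h; omega

theorem Reach.eq_of_depth_le [G.Graded] (h : G.Reach v w) (hd : G.depth v ≤ G.depth w) :
    v = w := by
  rcases h.cases_head with h | ⟨u, hvu, huw⟩
  · exact h
  · have := depth_of_iedge hvu
    have := Reach.depth_le huw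
    omega

theorem exists_isMeetingPoint [G.Graded] (hv : G.Reach v u) (hw : G.Reach w u) :
    ∃ m, G.IsMeetingPoint v w m := by
  let S := {m | G.Reach v m ∧ G.Reach w m}
  have hbdd : BddAbove (G.depth '' S) :=
    ⟨G.depth v, by rintro _ ⟨m, hm, rfl⟩; exact hm.1.depth_le⟩
  have hne : (G.depth '' S).Nonempty := ⟨_, u, ⟨hv, hw⟩, rfl⟩
  obtain ⟨m, hm, hmax⟩ := Nat.sSup_mem hne hbdd
  refine ⟨m, hm, fun x hvx hwx hxm => hxm.eq_of_depth_le ?_⟩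
  exact hmax ▸ le_csSup hbdd ⟨x, ⟨hvx, hwx⟩, rfl⟩

end Grading

section MeetingDepth

variable {α : Type*} {G K : LGraph α} {v w : G.V}

theorem meetingDepth_eq_neg_one (h : ∀ u, G.Reach v u → ¬ G.Reach w u) :
    G.meetingDepth v w = -1 :=
  if_neg fun ⟨u, hu, _⟩ => h u hu.1 hu.2

theorem IsMeetingPoint.meetingDepth_eq_zero {u : G.V} (h : G.IsMeetingPoint v w u)
    (hu : G.depth u = 0) : G.meetingDepth v w = 0 := by
  have hinf : sInf {n | ∃ u, G.IsMeetingPoint v w u ∧ G.depth u = n} = 0 :=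
    Nat.sInf_eq_zero.2 (.inl ⟨u, h, hu⟩)
  rw [meetingDepth, if_pos ⟨u, h⟩, hinf, Nat.cast_zero]

theorem Reach.meetingDepth_eq_depth [G.Graded] (h : G.Reach v w) :
    G.meetingDepth v w = G.depth w := by
  have hmeet : ∀ u, G.IsMeetingPoint v w u ↔ u = w := by
    refine fun u => ⟨fun hu => (hu.2 w h .refl hu.1.2).symm, ?_⟩
    rintro rfl
    exact ⟨⟨h, .refl⟩, fun x _ hwx hxw => hxw.eq_of_depth_le hwx.depth_le⟩
  simp [meetingDepth, hmeet]

theorem meetingDepth_eq_add {e : G.V → K.V} {k : ℕ} {v' w' : K.V}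
    (hex : ∃ m, G.IsMeetingPoint v w m)
    (hmeet : ∀ x, K.IsMeetingPoint v' w' x ↔ ∃ m, G.IsMeetingPoint v w m ∧ e m = x)
    (hdepth : ∀ m, K.depth (e m) = G.depth m + k) :
    K.meetingDepth v' w' = G.meetingDepth v w + k := by
  have hset : {n | ∃ x, K.IsMeetingPoint v' w' x ∧ K.depth x = n} =
      (· + k) '' {n | ∃ m, G.IsMeetingPoint v w m ∧ G.depth m = n} := by
    ext n
    simp only [hmeet, Set.mem_image, Set.mem_ofPred_eq]
    grind
  obtain ⟨m, hm⟩ := hex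
  have hinf := Monotone.map_csInf_of_continuousAt (f := (· + k : ℕ → ℕ))
    continuous_of_discreteTopology.continuousAt (fun _ _ h => Nat.add_le_add_right h k)
    (⟨_, m, hm, rfl⟩ : {n | ∃ m, G.IsMeetingPoint v w m ∧ G.depth m = n}.Nonempty)
    (OrderBot.bddBelow _)
  rw [meetingDepth, meetingDepth, if_pos ⟨e m, (hmeet _).2 ⟨m, hm, rfl⟩⟩, if_pos ⟨m, hm⟩, hset,
    ← hinf, Nat.cast_add]

theorem isMeetingPoint_comm {u : G.V} : G.IsMeetingPoint v w u ↔ G.IsMeetingPoint w v u := by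
  simp only [IsMeetingPoint]
  grind

theorem meetingDepth_comm (v w : G.V) : G.meetingDepth v w = G.meetingDepth w v := by
  have h : G.IsMeetingPoint v w = G.IsMeetingPoint w v :=
    funext fun _ => propext isMeetingPoint_comm
  rw [meetingDepth, meetingDepth, h]

theorem rel_comm {p : Polarity} : G.Rel p v w ↔ G.Rel p w v := by
  cases p <;> simp only [Rel, Conj, Disj, ne_comm, meetingDepth_comm v]

theorem Rel.ne {p : Polarity} (h : G.Rel p v w) : v ≠ w := by
  cases p <;> exact h.1

theorem rel_iff_of_meetingDepth_eq_neg_one (hne : v ≠ w) (h : G.meetingDepth v w = -1)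
    (p : Polarity) : G.Rel p v w ↔ p = .even := by
  cases p <;> simp [Rel, Conj, Disj, h, hne, Int.even_iff]

theorem rel_iff_of_meetingDepth_eq_zero (hne : v ≠ w) (h : G.meetingDepth v w = 0)
    (p : Polarity) : G.Rel p v w ↔ p = .odd := by
  cases p <;> simp [Rel, Conj, Disj, h, hne]

end MeetingDepth

/-- `e` embeds `G` in `K` as a set of vertices that is closed under `⟶`. -/
structure IsLowerEmb {α : Type*} {G K : LGraph α} (e : G.V → K.V) : Prop where
  injective : Function.Injective e
  iedge_iff : ∀ v x, K.iedge (e v) x ↔ ∃ w, G.iedge v w ∧ e w = x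

namespace IsLowerEmb

variable {α : Type*} {G K : LGraph α} {e : G.V → K.V} {v w : G.V}

theorem isRoot_iff (he : IsLowerEmb e) : K.IsRoot (e v) ↔ G.IsRoot v := by
  simp only [IsRoot, he.iedge_iff]
  grind

theorem isGrading_comp (he : IsLowerEmb e) {d : K.V → ℕ} (hd : K.IsGrading d) :
    G.IsGrading (d ∘ e) where
  of_iedge h := hd.of_iedge ((he.iedge_iff _ _).2 ⟨_, h, rfl⟩)
  exists_iedge h := by
    obtain ⟨x, hx⟩ := hd.exists_iedge h
    obtain ⟨w, hw, -⟩ := (he.iedge_iff _ _).1 hx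
    exact ⟨w, hw⟩

theorem depth_eq [hK : K.Graded] (he : IsLowerEmb e) (v : G.V) : K.depth (e v) = G.depth v :=
  (congrFun (he.isGrading_comp hK.isGrading_depth).depth_eq v).symm

theorem reach_iff_exists (he : IsLowerEmb e) {x : K.V} :
    K.Reach (e v) x ↔ ∃ w, G.Reach v w ∧ e w = x := by
  constructor
  · intro h
    induction h with
    | refl => exact ⟨v, .refl, rfl⟩
    | tail _ h ih =>
      obtain ⟨w, hw, rfl⟩ := ih
      obtain ⟨u, hu, rfl⟩ := (he.iedge_iff _ _).1 h
      exact ⟨u, .tail hw hu, rfl⟩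
  · rintro ⟨w, h, rfl⟩
    induction h with
    | refl => exact .refl
    | tail _ h ih => exact .tail ih ((he.iedge_iff _ _).2 ⟨_, h, rfl⟩)

theorem reach_iff (he : IsLowerEmb e) : K.Reach (e v) (e w) ↔ G.Reach v w := by
  simp only [he.reach_iff_exists, he.injective.eq_iff, exists_eq_right]

theorem isMeetingPoint_iff (he : IsLowerEmb e) {x : K.V} :
    K.IsMeetingPoint (e v) (e w) x ↔ ∃ m, G.IsMeetingPoint v w m ∧ e m = x := by
  constructor
  · rintro ⟨⟨hv, hw⟩, hmin⟩
    obtain ⟨m, hm, rfl⟩ := he.reach_iff_exists.1 hv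
    refine ⟨m, ⟨⟨hm, he.reach_iff.1 hw⟩, fun u hvu hwu hum => he.injective ?_⟩, rfl⟩
    exact hmin _ (he.reach_iff.2 hvu) (he.reach_iff.2 hwu) (he.reach_iff.2 hum)
  · rintro ⟨m, ⟨⟨hv, hw⟩, hmin⟩, rfl⟩
    refine ⟨⟨he.reach_iff.2 hv, he.reach_iff.2 hw⟩, fun u hvu hwu hum => ?_⟩
    obtain ⟨u, -, rfl⟩ := he.reach_iff_exists.1 hvu
    rw [hmin u (he.reach_iff.1 hvu) (he.reach_iff.1 hwu) (he.reach_iff.1 hum)]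

theorem meetingDepth_eq [K.Graded] (he : IsLowerEmb e) (v w : G.V) :
    K.meetingDepth (e v) (e w) = G.meetingDepth v w := by
  by_cases hex : ∃ m, G.IsMeetingPoint v w m
  · simpa only [Nat.cast_zero, add_zero] using
      meetingDepth_eq_add (k := 0) hex (fun _ => he.isMeetingPoint_iff) he.depth_eq
  · rw [meetingDepth, meetingDepth, if_neg hex, if_neg]
    exact fun ⟨x, hx⟩ => hex (let ⟨m, hm, _⟩ := he.isMeetingPoint_iff.1 hx; ⟨m, hm⟩)

theorem rel_iff [K.Graded] (he : IsLowerEmb e) {p : Polarity} :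
    K.Rel p (e v) (e w) ↔ G.Rel p v w := by
  cases p <;> simp only [Rel, Conj, Disj, he.meetingDepth_eq, ne_eq, he.injective.eq_iff]

end IsLowerEmb

theorem IsIso.isLowerEmb {α : Type*} {G K : LGraph α} {e : G.V → K.V} (he : IsIso e) :
    IsLowerEmb e where
  injective := he.bijective.1
  iedge_iff v x := by
    obtain ⟨w, rfl⟩ := he.bijective.2 x
    simp only [he.iedge_iff, he.bijective.1.eq_iff, exists_eq_right]

section Operations

variable {α : Type*} {G H : LGraph α}

theorem isLowerEmb_sum_inl : IsLowerEmb (G := G) (K := G.sum H) Sum.inl where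
  injective := Sum.inl_injective
  iedge_iff v := by rintro (x | x) <;> simp [sum]

theorem isLowerEmb_sum_inr : IsLowerEmb (G := H) (K := G.sum H) Sum.inr where
  injective := Sum.inr_injective
  iedge_iff v := by rintro (x | x) <;> simp [sum]

theorem isLowerEmb_arrow_inr : IsLowerEmb (G := H) (K := G.arrow H) Sum.inr where
  injective := Sum.inr_injective
  iedge_iff v := by rintro (x | x) <;> simp [arrow]

theorem IsGrading.sum {d : G.V → ℕ} {d' : H.V → ℕ} (hd : G.IsGrading d) (hd' : H.IsGrading d') :
    (G.sum H).IsGrading (Sum.elim d d') where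
  of_iedge {v w} h := by
    rcases v with v | v <;> rcases w with w | w
    exacts [hd.of_iedge h, h.elim, h.elim, hd'.of_iedge h]
  exists_iedge {v} h := by
    rcases v with v | v
    · exact (hd.exists_iedge h).elim fun w hw => ⟨.inl w, hw⟩
    · exact (hd'.exists_iedge h).elim fun w hw => ⟨.inr w, hw⟩

theorem isGrading_squig_iff {d : G.V ⊕ H.V → ℕ} :
    (G.squig H).IsGrading d ↔ (G.sum H).IsGrading d :=
  ⟨fun h => ⟨h.of_iedge, h.exists_iedge⟩, fun h => ⟨h.of_iedge, h.exists_iedge⟩⟩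

theorem IsGrading.arrow [Nonempty H.V] {d : G.V → ℕ} {d' : H.V → ℕ} (hd : G.IsGrading d)
    (hd' : H.IsGrading d') : (G.arrow H).IsGrading (Sum.elim (d · + 1) d') where
  of_iedge {v w} h := by
    rcases v with v | v <;> rcases w with w | w
    · exact congrArg (· + 1) (hd.of_iedge h)
    · simp only [Sum.elim_inl, Sum.elim_inr, hd.isRoot_iff.1 h.1, hd'.isRoot_iff.1 h.2]
    · exact h.elim
    · exact hd'.of_iedge h
  exists_iedge {v} h := by
    rcases v with v | v
    · by_cases hv : d v = 0
      · have := hd'.graded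
        obtain ⟨r, hr⟩ := exists_isRoot H
        exact ⟨.inr r, hd.isRoot_iff.2 hv, hr⟩
      · exact (hd.exists_iedge hv).elim fun w hw => ⟨.inl w, hw⟩
    · exact (hd'.exists_iedge h).elim fun w hw => ⟨.inr w, hw⟩

instance graded_single (l : Label α) : (single l).Graded :=
  IsGrading.graded (d := fun _ => 0) ⟨fun h => h.elim, fun h => (h rfl).elim⟩

variable [hG : G.Graded] [hH : H.Graded]

instance graded_sum : (G.sum H).Graded :=
  (hG.isGrading_depth.sum hH.isGrading_depth).graded

instance graded_squig : (G.squig H).Graded :=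
  (isGrading_squig_iff.2 (hG.isGrading_depth.sum hH.isGrading_depth)).graded

instance graded_arrow [Nonempty H.V] : (G.arrow H).Graded :=
  (hG.isGrading_depth.arrow hH.isGrading_depth).graded

theorem depth_sum (x : G.V ⊕ H.V) : (G.sum H).depth x = Sum.elim G.depth H.depth x :=
  congrFun (hG.isGrading_depth.sum hH.isGrading_depth).depth_eq x

theorem depth_squig (x : G.V ⊕ H.V) : (G.squig H).depth x = Sum.elim G.depth H.depth x :=
  congrFun (isGrading_squig_iff.2 (hG.isGrading_depth.sum hH.isGrading_depth)).depth_eq x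

theorem depth_arrow [Nonempty H.V] (x : G.V ⊕ H.V) :
    (G.arrow H).depth x = Sum.elim (G.depth · + 1) H.depth x :=
  congrFun (hG.isGrading_depth.arrow hH.isGrading_depth).depth_eq x

theorem not_isRoot_arrow_inl [Nonempty H.V] (v : G.V) : ¬ (G.arrow H).IsRoot (.inl v) :=
  isRoot_iff_depth_eq_zero.not.2 ((depth_arrow (.inl v)).trans_ne (Nat.succ_ne_zero _))

end Operations

section ArrowRelation

variable {α : Type*} {G H : LGraph α} {v w : G.V}

theorem reach_arrow_inl_inl : (G.arrow H).Reach (.inl v) (.inl w) ↔ G.Reach v w := by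
  refine ⟨fun h => ?_, fun h => Relation.ReflTransGen.lift Sum.inl (fun _ _ => id) _ _ h⟩
  generalize hx : Sum.inl w = x at h
  induction h generalizing w with
  | refl => cases hx; exact .refl
  | @tail y _ _ h ih =>
    subst hx
    rcases y with y | y
    exacts [.tail (ih rfl) h, h.elim]

theorem isRoot_of_reach_arrow_inl_inr {r : H.V} (h : (G.arrow H).Reach (.inl v) (.inr r)) :
    H.IsRoot r := by
  generalize hx : Sum.inr r = x at h
  induction h generalizing r with
  | refl => cases hx
  | @tail y _ _ h ih =>
    subst hx
    rcases y with y | y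
    exacts [h.2, (ih rfl r h).elim]

theorem reach_arrow_inl_inr [G.Graded] {r : H.V} :
    (G.arrow H).Reach (.inl v) (.inr r) ↔ H.IsRoot r := by
  refine ⟨isRoot_of_reach_arrow_inl_inr, fun hr => ?_⟩
  obtain ⟨s, hs, hvs⟩ := exists_reach_isRoot v
  exact .tail (reach_arrow_inl_inl.2 hvs) ⟨hs, hr⟩

theorem isMeetingPoint_arrow_inl_inr [G.Graded] {x : H.V} {r : H.V} (hr : H.IsRoot r)
    (hxr : H.Reach x r) : (G.arrow H).IsMeetingPoint (.inl v) (.inr x) (.inr r) := by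
  refine ⟨⟨reach_arrow_inl_inr.2 hr, isLowerEmb_arrow_inr.reach_iff.2 hxr⟩, ?_⟩
  rintro u hvu hxu hur
  obtain ⟨u, -, rfl⟩ := isLowerEmb_arrow_inr.reach_iff_exists.1 hxu
  exact (isLowerEmb_arrow_inr.isRoot_iff.2 (isRoot_of_reach_arrow_inl_inr hvu)).eq_of_reach hur

theorem meetingDepth_arrow_inl_inr [G.Graded] [H.Graded] (v : G.V) (x : H.V) :
    (G.arrow H).meetingDepth (.inl v) (.inr x) = 0 := by
  have : Nonempty H.V := ⟨x⟩
  obtain ⟨r, hr, hxr⟩ := exists_reach_isRoot x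
  exact (isMeetingPoint_arrow_inl_inr hr hxr).meetingDepth_eq_zero
    ((depth_arrow _).trans (isRoot_iff_depth_eq_zero.1 hr))

theorem isMeetingPoint_arrow_inl_inl_of_forall [G.Graded] {r : H.V} (hr : H.IsRoot r)
    (h : ∀ u, G.Reach v u → ¬ G.Reach w u) :
    (G.arrow H).IsMeetingPoint (.inl v) (.inl w) (.inr r) := by
  refine ⟨⟨reach_arrow_inl_inr.2 hr, reach_arrow_inl_inr.2 hr⟩, ?_⟩
  rintro (u | u) hvu hwu hur
  · exact (h u (reach_arrow_inl_inl.1 hvu) (reach_arrow_inl_inl.1 hwu)).elim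
  · exact (isLowerEmb_arrow_inr.isRoot_iff.2 (reach_arrow_inl_inr.1 hvu)).eq_of_reach hur

theorem isMeetingPoint_arrow_inl_inl [G.Graded] (hex : ∃ m, G.IsMeetingPoint v w m)
    (x : G.V ⊕ H.V) : (G.arrow H).IsMeetingPoint (.inl v) (.inl w) x ↔
      ∃ m, G.IsMeetingPoint v w m ∧ Sum.inl m = x := by
  constructor
  · rintro ⟨⟨hv, hw⟩, hmin⟩
    rcases x with m | r
    · refine ⟨m, ⟨⟨reach_arrow_inl_inl.1 hv, reach_arrow_inl_inl.1 hw⟩, fun u hvu hwu hum => ?_⟩,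
        rfl⟩
      exact Sum.inl_injective (hmin (.inl u) (reach_arrow_inl_inl.2 hvu)
        (reach_arrow_inl_inl.2 hwu) (reach_arrow_inl_inl.2 hum))
    · obtain ⟨m, ⟨hvm, hwm⟩, -⟩ := hex
      exact (Sum.inl_ne_inr (hmin (.inl m) (reach_arrow_inl_inl.2 hvm)
        (reach_arrow_inl_inl.2 hwm) (reach_arrow_inl_inr.2 (reach_arrow_inl_inr.1 hv)))).elim
  · rintro ⟨m, ⟨⟨hv, hw⟩, hmin⟩, rfl⟩
    refine ⟨⟨reach_arrow_inl_inl.2 hv, reach_arrow_inl_inl.2 hw⟩, ?_⟩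
    rintro (u | u) hvu hwu hum
    · rw [hmin u (reach_arrow_inl_inl.1 hvu) (reach_arrow_inl_inl.1 hwu)
        (reach_arrow_inl_inl.1 hum)]
    · obtain ⟨_, -, h⟩ := isLowerEmb_arrow_inr.reach_iff_exists.1 hum
      cases h

theorem meetingDepth_arrow_inl_inl [G.Graded] [H.Graded] [Nonempty H.V] (v w : G.V) :
    (G.arrow H).meetingDepth (.inl v) (.inl w) = G.meetingDepth v w + 1 := by
  by_cases hex : ∃ m, G.IsMeetingPoint v w m
  · exact meetingDepth_eq_add (K := G.arrow H) hex (isMeetingPoint_arrow_inl_inl hex)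
      fun m => depth_arrow (.inl m)
  · obtain ⟨r, hr⟩ := exists_isRoot H
    have hdisjoint : ∀ u, G.Reach v u → ¬ G.Reach w u :=
      fun u hvu hwu => hex (exists_isMeetingPoint hvu hwu)
    rw [meetingDepth_eq_neg_one hdisjoint]
    exact (isMeetingPoint_arrow_inl_inl_of_forall hr hdisjoint).meetingDepth_eq_zero
      ((depth_arrow _).trans (isRoot_iff_depth_eq_zero.1 hr))

end ArrowRelation

end LGraph

/-- The relation on a disjoint union that extends `R` and `S` and relates the two summands
completely if `c` holds, and not at all otherwise: the join or the disjoint union of two graphs. -/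
def joinRel {V W : Type*} (c : Prop) (R : V → V → Prop) (S : W → W → Prop) :
    V ⊕ W → V ⊕ W → Prop
  | .inl v, .inl w => R v w
  | .inr v, .inr w => S v w
  | _, _ => c

namespace LGraph

section RelOperations

variable {α : Type*} (G H : LGraph α) [G.Graded] [H.Graded] (p : Polarity)

theorem rel_sum : (G.sum H).Rel p = joinRel (p = .even) (G.Rel p) (H.Rel p) := by
  have hsep : ∀ v w, (G.sum H).Rel p (.inl v) (.inr w) ↔ p = .even := fun v w =>
    rel_iff_of_meetingDepth_eq_neg_one Sum.inl_ne_inr (meetingDepth_eq_neg_one fun u hvu hwu => by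
      obtain ⟨_, -, rfl⟩ := isLowerEmb_sum_inl.reach_iff_exists.1 hvu
      obtain ⟨_, -, h⟩ := isLowerEmb_sum_inr.reach_iff_exists.1 hwu
      cases h) p
  ext (v | v) (w | w)
  exacts [isLowerEmb_sum_inl.rel_iff, hsep v w, rel_comm.trans (hsep w v),
    isLowerEmb_sum_inr.rel_iff]

theorem rel_arrow [Nonempty H.V] :
    (G.arrow H).Rel p = joinRel (p = .odd) (G.Rel p.flip) (H.Rel p) := by
  have hinl : ∀ v w, (G.arrow H).Rel p (.inl v) (.inl w) ↔ G.Rel p.flip v w := fun v w => by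
    have hne : (Sum.inl v : G.V ⊕ H.V) ≠ .inl w ↔ v ≠ w := Sum.inl_injective.ne_iff
    have hdepth := meetingDepth_arrow_inl_inl (H := H) v w
    cases p
    · exact and_congr hne (by rw [hdepth, ← Int.not_even_iff_odd, Int.even_add_one, not_not])
    · exact and_congr hne (by rw [hdepth, Int.even_add_one, Int.not_even_iff_odd])
  have hcross : ∀ v w, (G.arrow H).Rel p (.inl v) (.inr w) ↔ p = .odd := fun v w =>
    rel_iff_of_meetingDepth_eq_zero Sum.inl_ne_inr (meetingDepth_arrow_inl_inr v w) p
  ext (v | v) (w | w)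
  exacts [hinl v w, hcross v w, rel_comm.trans (hcross w v), isLowerEmb_arrow_inr.rel_iff]

end RelOperations

theorem rel_squig {α : Type*} (G H : LGraph α) [G.Graded] [H.Graded] (p : Polarity) :
    (G.squig H).Rel p = joinRel (p = .even) (G.Rel p) (H.Rel p) := by
  rw [← rel_sum]
  have h : IsLowerEmb (G := G.sum H) (K := G.squig H) id :=
    ⟨Function.injective_id, fun v x =>
      ⟨fun hvx => ⟨x, hvx, rfl⟩, by rintro ⟨_, hvx, rfl⟩; exact hvx⟩⟩
  ext v w
  exact h.rel_iff

end LGraph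

namespace Formula

variable {α : Type*} (F : Formula α)

instance nonempty_arena : Nonempty F.arena.V := by
  induction F with
  | atom a => exact ⟨()⟩
  | imp A B ihA _ => exact ihA.map Sum.inl
  | and A B ihA _ => exact ihA.map Sum.inl
  | box A _ => exact ⟨.inl ()⟩
  | dia A _ => exact ⟨.inl ()⟩
  | diaBot => exact ⟨()⟩

instance graded_arena : F.arena.Graded := by
  induction F with
  | atom a => exact LGraph.graded_single _
  | imp A B _ _ => exact LGraph.graded_arrow
  | and A B _ _ => exact LGraph.graded_sum
  | box A _ => exact LGraph.graded_squig
  | dia A _ => exact LGraph.graded_squig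
  | diaBot => exact LGraph.graded_single _

end Formula

section MaxClique

variable {V W : Type*} {R : V → V → Prop} {S : W → W → Prop} {c : Prop}

/-- `K` is a maximal clique of the symmetric relation `R`: its elements are exactly the points
that are related to all other elements of `K`. -/
def IsMaxClique (R : V → V → Prop) (K : Set V) : Prop :=
  ∀ v, v ∈ K ↔ ∀ w ∈ K, w ≠ v → R w v

theorem exists_isMaxClique (hR : ∀ v w, R v w → R w v) (v : V) :
    ∃ K, IsMaxClique R K ∧ v ∈ K := by
  obtain ⟨K, hK, hv⟩ := (Set.subsingleton_singleton (a := v)).isChain (r := R).exists_maxChain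
  refine ⟨K, fun x => ⟨fun hx y hy hyx => (hK.1 hy hx hyx).elim id (hR _ _), fun hx => ?_⟩, hv rfl⟩
  have hchain : IsChain R (insert x K) := hK.1.insert fun y hy hxy => .inr (hx y hy hxy.symm)
  exact hK.2 hchain (Set.subset_insert x K) ▸ Set.mem_insert x K

theorem IsMaxClique.nonempty [Nonempty V] {K : Set V} (hK : IsMaxClique R K) : K.Nonempty := by
  by_contra! hempty
  simpa [hempty] using hK (Classical.arbitrary V)

theorem isMaxClique_joinRel_iff_and (hc : c) {K : Set (V ⊕ W)} :
    IsMaxClique (joinRel c R S) K ↔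
      IsMaxClique R (Sum.inl ⁻¹' K) ∧ IsMaxClique S (Sum.inr ⁻¹' K) := by
  simp [IsMaxClique, Sum.forall, joinRel, hc]

theorem isMaxClique_joinRel_iff_or [Nonempty V] [Nonempty W] (hc : ¬ c) {K : Set (V ⊕ W)} :
    IsMaxClique (joinRel c R S) K ↔
      IsMaxClique R (Sum.inl ⁻¹' K) ∧ Sum.inr ⁻¹' K = ∅ ∨
        Sum.inl ⁻¹' K = ∅ ∧ IsMaxClique S (Sum.inr ⁻¹' K) := by
  have hsplit : IsMaxClique (joinRel c R S) K ↔
      (∀ v, .inl v ∈ K ↔ (∀ w, .inl w ∈ K → w ≠ v → R w v) ∧ Sum.inr ⁻¹' K = ∅) ∧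
        ∀ w, .inr w ∈ K ↔ Sum.inl ⁻¹' K = ∅ ∧ ∀ v, .inr v ∈ K → v ≠ w → S v w := by
    simp [IsMaxClique, Sum.forall, joinRel, hc, Set.eq_empty_iff_forall_notMem]
  rw [hsplit]
  constructor
  · rintro ⟨hl, hr⟩
    rcases (Sum.inr ⁻¹' K).eq_empty_or_nonempty with h | ⟨w, hw⟩
    · exact .inl ⟨fun v => by simpa [h] using hl v, h⟩
    · have h := ((hr w).1 hw).1
      exact .inr ⟨h, fun v => by simpa [h] using hr v⟩
  · rintro (⟨hl, h⟩ | ⟨h, hr⟩)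
    · have hne := hl.nonempty.ne_empty
      exact ⟨fun v => by simpa [h] using hl v, fun w => by
        simpa [hne] using Set.eq_empty_iff_forall_notMem.1 h w⟩
    · have hne := hr.nonempty.ne_empty
      exact ⟨fun v => by simpa [hne] using Set.eq_empty_iff_forall_notMem.1 h v,
        fun w => by simpa [h] using hr w⟩

theorem IsMaxClique.image_sumMap {V' W' : Type*} [Nonempty V] [Nonempty W] {R' : V' → V' → Prop}
    {S' : W' → W' → Prop} {f : V → V'} {g : W → W'}
    (hf : ∀ K, IsMaxClique R K → IsMaxClique R' (f '' K))
    (hg : ∀ K, IsMaxClique S K → IsMaxClique S' (g '' K)) {K : Set (V ⊕ W)}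
    (hK : IsMaxClique (joinRel c R S) K) :
    IsMaxClique (joinRel c R' S') (Sum.map f g '' K) := by
  have : Nonempty V' := .map f ‹_›
  have : Nonempty W' := .map g ‹_›
  have hinl : Sum.inl ⁻¹' (Sum.map f g '' K) = f '' (Sum.inl ⁻¹' K) := by ext; simp [Sum.exists]
  have hinr : Sum.inr ⁻¹' (Sum.map f g '' K) = g '' (Sum.inr ⁻¹' K) := by ext; simp [Sum.exists]
  by_cases hc : c
  · rw [isMaxClique_joinRel_iff_and hc] at hK ⊢
    rw [hinl, hinr]
    exact hK.imp (hf _) (hg _)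
  · rw [isMaxClique_joinRel_iff_or hc] at hK ⊢
    rw [hinl, hinr, Set.image_eq_empty, Set.image_eq_empty]
    exact hK.imp (.imp_left (hf _)) (.imp_right (hg _))

theorem IsMaxClique.image_sumInl [Nonempty V] [Nonempty W] (hc : ¬ c) {K : Set V}
    (hK : IsMaxClique R K) : IsMaxClique (joinRel c R S) (Sum.inl '' K) := by
  rw [isMaxClique_joinRel_iff_or hc, Set.preimage_image_eq _ Sum.inl_injective]
  exact .inl ⟨hK, Set.preimage_inr_image_inl K⟩

theorem IsMaxClique.image_sumInr [Nonempty V] [Nonempty W] (hc : ¬ c) {K : Set W}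
    (hK : IsMaxClique S K) : IsMaxClique (joinRel c R S) (Sum.inr '' K) := by
  rw [isMaxClique_joinRel_iff_or hc, Set.preimage_image_eq _ Sum.inr_injective]
  exact .inr ⟨Set.preimage_inl_image_inr K, hK⟩

theorem IsMaxClique.image_codiagonal [Nonempty V] (hc : ¬ c) {K : Set (V ⊕ V)}
    (hK : IsMaxClique (joinRel c R R) K) : IsMaxClique R (Sum.elim id id '' K) := by
  have himage : Sum.elim id id '' K = Sum.inl ⁻¹' K ∪ Sum.inr ⁻¹' K := by
    ext
    simp [Sum.exists]
  rcases (isMaxClique_joinRel_iff_or hc).1 hK with ⟨h, hempty⟩ | ⟨hempty, h⟩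
  · rwa [himage, hempty, Set.union_empty]
  · rwa [himage, hempty, Set.empty_union]

theorem IsMaxClique.image_of_bijective {f : V → W} (hf : Function.Bijective f)
    (hRS : ∀ v w, S (f v) (f w) ↔ R v w) {K : Set V} (hK : IsMaxClique R K) :
    IsMaxClique S (f '' K) := by
  simpa [IsMaxClique, hf.surjective.forall, hf.injective.mem_set_image, hf.injective.eq_iff, hRS]
    using hK

end MaxClique

section SkewLifting

variable {V W V' W' : Type*} {R : V → V → Prop} {S : W → W → Prop} {R' : V' → V' → Prop}
  {S' : W' → W' → Prop} {c : Prop}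

/-- The lifting property of skew fibrations, for arbitrary relations on source and target. -/
def HasSkewLifting (R : V → V → Prop) (S : W → W → Prop) (f : V → W) : Prop :=
  ∀ v w, S (f v) w → ∃ u, R v u ∧ ¬ S (f u) w

theorem HasSkewLifting.of_image_isMaxClique (hR : ∀ v w, R v w → R w v) (hS : ∀ w, ¬ S w w)
    {f : V → W} (hf : ∀ K, IsMaxClique R K → IsMaxClique S (f '' K)) : HasSkewLifting R S f := by
  intro v w hvw
  obtain ⟨K, hK, hv⟩ := exists_isMaxClique hR v
  by_contra! hrel
  have hall : ∀ x ∈ K, S (f x) w := fun x hx => by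
    by_cases hvx : v = x
    · exact hvx ▸ hvw
    · exact hrel x ((hK x).1 hx v hv hvx)
  obtain ⟨x, hx, rfl⟩ : w ∈ f '' K :=
    (hf K hK w).2 (Set.forall_mem_image.2 fun x hx _ => hall x hx)
  exact hS _ (hall x hx)

theorem HasSkewLifting.of_sumMap_left {f : V → V'} {g : W → W'}
    (h : HasSkewLifting (joinRel c R S) (joinRel c R' S') (Sum.map f g)) :
    HasSkewLifting R R' f := by
  intro v w hvw
  obtain ⟨u | u, hvu, huw⟩ := h (.inl v) (.inl w) hvw
  exacts [⟨u, hvu, huw⟩, (huw hvu).elim]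

theorem HasSkewLifting.of_sumMap_right {f : V → V'} {g : W → W'}
    (h : HasSkewLifting (joinRel c R S) (joinRel c R' S') (Sum.map f g)) :
    HasSkewLifting S S' g := by
  intro v w hvw
  obtain ⟨u | u, hvu, huw⟩ := h (.inr v) (.inr w) hvw
  exacts [(huw hvu).elim, ⟨u, hvu, huw⟩]

end SkewLifting

namespace LGraph

section Isomorphism

variable {α : Type*} {G H K : LGraph α}

theorem IsIso.refl (G : LGraph α) : IsIso (id : G.V → G.V) :=
  ⟨Function.bijective_id, fun _ _ => .rfl, fun _ _ => .rfl, fun _ => rfl⟩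

theorem IsIso.symm {e : G.V ≃ H.V} (he : IsIso e) : IsIso e.symm where
  bijective := e.symm.bijective
  iedge_iff v w := by simpa using (he.iedge_iff (e.symm v) (e.symm w)).symm
  medge_iff v w := by simpa using (he.medge_iff (e.symm v) (e.symm w)).symm
  lab_eq v := by simpa using (he.lab_eq (e.symm v)).symm

theorem IsIso.comp {e : G.V → H.V} {f : H.V → K.V} (hf : IsIso f) (he : IsIso e) :
    IsIso (f ∘ e) where
  bijective := hf.bijective.comp he.bijective
  iedge_iff _ _ := (hf.iedge_iff _ _).trans (he.iedge_iff _ _)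
  medge_iff _ _ := (hf.medge_iff _ _).trans (he.medge_iff _ _)
  lab_eq _ := (hf.lab_eq _).trans (he.lab_eq _)

end Isomorphism

section ModalHom

variable {α : Type*} {G H K : LGraph α}

theorem IsModalHom.isRoot_iff [H.Graded] [G.Graded] {f : H.V → G.V} (hf : IsModalHom f)
    {v : H.V} : G.IsRoot (f v) ↔ H.IsRoot v := by
  rw [isRoot_iff_depth_eq_zero, isRoot_iff_depth_eq_zero, hf.depth]

theorem IsModalHom.comp {f : H.V → K.V} {g : K.V → G.V} (hg : IsModalHom g)
    (hf : IsModalHom f) : IsModalHom (g ∘ f) where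
  iedge v w h := hg.iedge _ _ (hf.iedge _ _ h)
  medge v w h := hg.medge _ _ (hf.medge _ _ h)
  depth v := (hf.depth v).trans (hg.depth _)
  lab v := (hf.lab v).trans (hg.lab _)
  modal v u h := by
    obtain ⟨w, hw, rfl⟩ := hg.modal v _ h
    obtain ⟨x, hx, rfl⟩ := hf.modal w u hw
    exact ⟨x, hx, rfl⟩

end ModalHom

/-- Embeddings that preserve and reflect both kinds of edges, labels, depth, conjunctness and
disjunctness. -/
structure IsFullEmb {α : Type*} {G K : LGraph α} (e : G.V → K.V) : Prop where
  injective : Function.Injective e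
  iedge_iff : ∀ v w, K.iedge (e v) (e w) ↔ G.iedge v w
  medge_iff : ∀ v w, K.medge (e v) (e w) ↔ G.medge v w
  lab_eq : ∀ v, K.lab (e v) = G.lab v
  depth_eq : ∀ v, K.depth (e v) = G.depth v
  rel_iff : ∀ p v w, K.Rel p (e v) (e w) ↔ G.Rel p v w

section FullEmb

variable {α : Type*} {G H K : LGraph α} {e : G.V → K.V}

theorem IsLowerEmb.isFullEmb [K.Graded] (he : IsLowerEmb e)
    (hmedge : ∀ v w, K.medge (e v) (e w) ↔ G.medge v w) (hlab : ∀ v, K.lab (e v) = G.lab v) :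
    IsFullEmb e where
  injective := he.injective
  iedge_iff v w := by simp only [he.iedge_iff, he.injective.eq_iff, exists_eq_right]
  medge_iff := hmedge
  lab_eq := hlab
  depth_eq := he.depth_eq
  rel_iff _ _ _ := he.rel_iff

theorem IsIso.isFullEmb [K.Graded] (he : IsIso e) : IsFullEmb e :=
  he.isLowerEmb.isFullEmb he.medge_iff he.lab_eq

namespace IsFullEmb

theorem isIso (he : IsFullEmb e) (hsurj : Function.Surjective e) : IsIso e :=
  ⟨⟨he.injective, hsurj⟩, he.iedge_iff, he.medge_iff, he.lab_eq⟩

theorem comp {f : K.V → H.V} (hf : IsFullEmb f) (he : IsFullEmb e) : IsFullEmb (f ∘ e) where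
  injective := hf.injective.comp he.injective
  iedge_iff _ _ := (hf.iedge_iff _ _).trans (he.iedge_iff _ _)
  medge_iff _ _ := (hf.medge_iff _ _).trans (he.medge_iff _ _)
  lab_eq _ := (hf.lab_eq _).trans (he.lab_eq _)
  depth_eq _ := (hf.depth_eq _).trans (he.depth_eq _)
  rel_iff p _ _ := (hf.rel_iff p _ _).trans (he.rel_iff p _ _)

theorem isRoot_iff [G.Graded] [K.Graded] (he : IsFullEmb e) {v : G.V} :
    K.IsRoot (e v) ↔ G.IsRoot v := by
  rw [isRoot_iff_depth_eq_zero, isRoot_iff_depth_eq_zero, he.depth_eq]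

theorem isModalHom (he : IsFullEmb e)
    (hmodal : ∀ x u, K.medge x (e u) → ∃ w, G.medge w u ∧ e w = x) : IsModalHom e where
  iedge _ _ := (he.iedge_iff _ _).2
  medge _ _ := (he.medge_iff _ _).2
  depth v := (he.depth_eq v).symm
  lab v := (he.lab_eq v).symm
  modal := hmodal

theorem isModalHom_of_comp (he : IsFullEmb e) {f : H.V → G.V} (hf : IsModalHom (e ∘ f)) :
    IsModalHom f where
  iedge v w h := (he.iedge_iff _ _).1 (hf.iedge v w h)
  medge v w h := (he.medge_iff _ _).1 (hf.medge v w h)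
  depth v := (hf.depth v).trans (he.depth_eq _)
  lab v := (hf.lab v).trans (he.lab_eq _)
  modal v u h := by
    obtain ⟨w, hw, hv⟩ := hf.modal (e v) u ((he.medge_iff _ _).2 h)
    exact ⟨w, hw, he.injective hv⟩

theorem isSkewFibration_of_comp {p : Polarity} (he : IsFullEmb e) {f : H.V → G.V}
    (hf : IsSkewFibration p (e ∘ f)) : IsSkewFibration p f where
  toIsModalHom := he.isModalHom_of_comp hf.toIsModalHom
  preserves v w h := (he.rel_iff _ _ _).1 (hf.preserves v w h)
  lifting v w h := by
    obtain ⟨u, hvu, huw⟩ := hf.lifting v (e w) ((he.rel_iff _ _ _).2 h)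
    exact ⟨u, hvu, mt (he.rel_iff _ _ _).2 huw⟩

end IsFullEmb

theorem IsIso.isModalHom [K.Graded] (he : IsIso e) : IsModalHom e :=
  he.isFullEmb.isModalHom fun x u h => by
    obtain ⟨w, rfl⟩ := he.bijective.2 x
    exact ⟨w, (he.medge_iff _ _).1 h, rfl⟩

theorem IsSkewFibration.comp_isIso {p : Polarity} [K.Graded] {f : K.V → H.V}
    (hf : IsSkewFibration p f) (he : IsIso e) : IsSkewFibration p (f ∘ e) where
  toIsModalHom := hf.toIsModalHom.comp he.isModalHom
  preserves v w h := hf.preserves _ _ ((he.isFullEmb.rel_iff _ _ _).2 h)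
  lifting v w h := by
    obtain ⟨x, hvx, hxw⟩ := hf.lifting (e v) w h
    obtain ⟨u, rfl⟩ := he.bijective.2 x
    exact ⟨u, (he.isFullEmb.rel_iff _ _ _).1 hvx, hxw⟩

end FullEmb

section Injections

variable {α : Type*} {G H : LGraph α} [G.Graded] [H.Graded]

theorem isFullEmb_sum_inl : IsFullEmb (G := G) (K := G.sum H) Sum.inl :=
  isLowerEmb_sum_inl.isFullEmb (fun _ _ => .rfl) fun _ => rfl

theorem isFullEmb_sum_inr : IsFullEmb (G := H) (K := G.sum H) Sum.inr :=
  isLowerEmb_sum_inr.isFullEmb (fun _ _ => .rfl) fun _ => rfl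

theorem isFullEmb_arrow_inr [Nonempty H.V] : IsFullEmb (G := H) (K := G.arrow H) Sum.inr :=
  isLowerEmb_arrow_inr.isFullEmb (fun _ _ => .rfl) fun _ => rfl

theorem isFullEmb_squig_inl : IsFullEmb (G := G) (K := G.squig H) Sum.inl :=
  IsLowerEmb.isFullEmb ⟨Sum.inl_injective, isLowerEmb_sum_inl.iedge_iff⟩ (fun _ _ => .rfl)
    fun _ => rfl

theorem isFullEmb_squig_inr : IsFullEmb (G := H) (K := G.squig H) Sum.inr :=
  IsLowerEmb.isFullEmb ⟨Sum.inr_injective, isLowerEmb_sum_inr.iedge_iff⟩ (fun _ _ => .rfl)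
    fun _ => rfl

theorem isModalHom_sum_inl : IsModalHom (H := G) (G := G.sum H) Sum.inl :=
  isFullEmb_sum_inl.isModalHom (by rintro (x | x) u h; exacts [⟨x, h, rfl⟩, h.elim])

theorem isModalHom_sum_inr : IsModalHom (H := H) (G := G.sum H) Sum.inr :=
  isFullEmb_sum_inr.isModalHom (by rintro (x | x) u h; exacts [h.elim, ⟨x, h, rfl⟩])

theorem isModalHom_arrow_inr [Nonempty H.V] : IsModalHom (H := H) (G := G.arrow H) Sum.inr :=
  isFullEmb_arrow_inr.isModalHom (by rintro (x | x) u h; exacts [h.elim, ⟨x, h, rfl⟩])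

theorem isModalHom_squig_inl : IsModalHom (H := G) (G := G.squig H) Sum.inl :=
  isFullEmb_squig_inl.isModalHom (by rintro (x | x) u h; exacts [⟨x, h, rfl⟩, h.elim])

end Injections

section FunctorialMaps

variable {α : Type*} {H₁ H₂ G₁ G₂ : LGraph α} [H₁.Graded] [H₂.Graded]

theorem isModalHom_copair_iff {G : LGraph α} {f₁ : H₁.V → G.V} {f₂ : H₂.V → G.V} :
    IsModalHom (copair f₁ f₂) ↔ IsModalHom f₁ ∧ IsModalHom f₂ := by
  refine ⟨fun h => ⟨h.comp isModalHom_sum_inl, h.comp isModalHom_sum_inr⟩, fun ⟨h₁, h₂⟩ => ?_⟩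
  constructor
  · rintro (v | v) (w | w) h
    exacts [h₁.iedge _ _ h, h.elim, h.elim, h₂.iedge _ _ h]
  · rintro (v | v) (w | w) h
    exacts [h₁.medge _ _ h, h.elim, h.elim, h₂.medge _ _ h]
  · rintro (v | v)
    exacts [(depth_sum _).trans (h₁.depth v), (depth_sum _).trans (h₂.depth v)]
  · rintro (v | v)
    exacts [h₁.lab v, h₂.lab v]
  · rintro v (u | u) h
    · obtain ⟨w, hw, rfl⟩ := h₁.modal v u h
      exact ⟨.inl w, hw, rfl⟩
    · obtain ⟨w, hw, rfl⟩ := h₂.modal v u h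
      exact ⟨.inr w, hw, rfl⟩

variable [G₁.Graded] [G₂.Graded] {f₁ : H₁.V → G₁.V} {f₂ : H₂.V → G₂.V}

theorem isModalHom_sumMap_iff :
    IsModalHom (sumMap f₁ f₂) ↔ IsModalHom f₁ ∧ IsModalHom f₂ :=
  isModalHom_copair_iff.trans <| and_congr
    ⟨isFullEmb_sum_inl.isModalHom_of_comp, isModalHom_sum_inl.comp⟩
    ⟨isFullEmb_sum_inr.isModalHom_of_comp, isModalHom_sum_inr.comp⟩

theorem IsModalHom.of_arrowMap_left [Nonempty H₂.V] [Nonempty G₂.V]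
    (h : IsModalHom (arrowMap f₁ f₂)) : IsModalHom f₁ where
  iedge v w e := h.iedge (.inl v) (.inl w) e
  medge v w e := h.medge (.inl v) (.inl w) e
  depth v := Nat.succ_injective <|
    (depth_arrow (.inl v)).symm.trans ((h.depth (.inl v)).trans (depth_arrow _))
  lab v := h.lab (.inl v)
  modal v u e := by
    obtain ⟨w | w, hw, he⟩ := h.modal (.inl v) (.inl u) e
    exacts [⟨w, hw, Sum.inl_injective he⟩, hw.elim]

theorem IsModalHom.arrowMap [Nonempty H₂.V] [Nonempty G₂.V] (h₁ : IsModalHom f₁)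
    (h₂ : IsModalHom f₂) : IsModalHom (arrowMap f₁ f₂) where
  iedge := by
    rintro (v | v) (w | w) h
    exacts [h₁.iedge _ _ h, ⟨h₁.isRoot_iff.2 h.1, h₂.isRoot_iff.2 h.2⟩, h.elim, h₂.iedge _ _ h]
  medge := (isModalHom_sumMap_iff.2 ⟨h₁, h₂⟩).medge
  depth := by
    rintro (v | v)
    · exact (depth_arrow _).trans
        ((congrArg (· + 1) (h₁.depth v)).trans (depth_arrow (.inl _)).symm)
    · exact (depth_arrow _).trans ((h₂.depth v).trans (depth_arrow (.inr _)).symm)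
  lab := (isModalHom_sumMap_iff.2 ⟨h₁, h₂⟩).lab
  modal := (isModalHom_sumMap_iff.2 ⟨h₁, h₂⟩).modal

theorem isModalHom_arrowMap_iff [Nonempty H₂.V] [Nonempty G₂.V] :
    IsModalHom (arrowMap f₁ f₂) ↔ IsModalHom f₁ ∧ IsModalHom f₂ :=
  ⟨fun h => ⟨h.of_arrowMap_left,
    isFullEmb_arrow_inr.isModalHom_of_comp (h.comp isModalHom_arrow_inr)⟩,
    fun h => h.1.arrowMap h.2⟩

end FunctorialMaps

theorem isModalHom_squigMap_iff {α : Type*} {G H K : LGraph α} [G.Graded] [H.Graded] [K.Graded]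
    {f : H.V → G.V} : IsModalHom (squigMap (H₁ := K) (G₁ := K) id f) ↔ IsModalHom f := by
  refine ⟨fun h => ⟨fun v w e => h.iedge (.inr v) (.inr w) e,
    fun v w e => h.medge (.inr v) (.inr w) e,
    fun v => (depth_squig (.inr v)).symm.trans ((h.depth (.inr v)).trans (depth_squig _)),
    fun v => h.lab (.inr v), fun v u e => ?_⟩, fun h => ?_⟩
  · obtain ⟨w | w, hw, he⟩ := h.modal (.inr v) (.inr u) e
    exacts [(Sum.inl_ne_inr he).elim, ⟨w, hw, Sum.inr_injective he⟩]
  · have hsum : IsModalHom (sumMap (H₁ := K) (G₁ := K) id f) :=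
      isModalHom_sumMap_iff.2 ⟨(IsIso.refl K).isModalHom, h⟩
    refine ⟨hsum.iedge, ?_, fun v => ?_, hsum.lab, ?_⟩
    · rintro (v | v) (w | w) e
      exacts [e, ⟨e.1, h.isRoot_iff.2 e.2⟩, e.elim, h.medge _ _ e]
    · exact (depth_squig v).trans ((depth_sum v).symm.trans ((hsum.depth v).trans
        ((depth_sum _).trans (depth_squig _).symm)))
    · rintro (v | v) (u | u) e
      · exact ⟨.inl v, e, rfl⟩
      · exact ⟨.inl v, ⟨e.1, h.isRoot_iff.1 e.2⟩, rfl⟩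
      · exact e.elim
      · obtain ⟨w, hw, rfl⟩ := h.modal v u e
        exact ⟨.inr w, hw, rfl⟩

end LGraph

section JoinRel

variable {V W V' W' : Type*} {c : Prop}

theorem joinRel_map_map {R : V' → V' → Prop} {S : W' → W' → Prop} {f : V → V'} {g : W → W'}
    (x y : V ⊕ W) : joinRel c R S (Sum.map f g x) (Sum.map f g y) ↔
      joinRel c (fun v w => R (f v) (f w)) (fun v w => S (g v) (g w)) x y := by
  rcases x with x | x <;> rcases y with y | y <;> exact .rfl

theorem joinRel_mono {R R' : V → V → Prop} {S S' : W → W → Prop} (hR : ∀ v w, R v w → R' v w)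
    (hS : ∀ v w, S v w → S' v w) : ∀ x y, joinRel c R S x y → joinRel c R' S' x y
  | .inl _, .inl _ => hR _ _
  | .inl _, .inr _ => id
  | .inr _, .inl _ => id
  | .inr _, .inr _ => hS _ _

end JoinRel

namespace LGraph

namespace IsFullEmb

variable {α : Type*} {H₁ H₂ G₁ G₂ : LGraph α} [H₁.Graded] [H₂.Graded] [G₁.Graded] [G₂.Graded]
  {f₁ : H₁.V → G₁.V} {f₂ : H₂.V → G₂.V}

theorem sumMap (h₁ : IsFullEmb f₁) (h₂ : IsFullEmb f₂) : IsFullEmb (sumMap f₁ f₂) where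
  injective := Sum.map_injective.2 ⟨h₁.injective, h₂.injective⟩
  iedge_iff := by
    rintro (v | v) (w | w)
    exacts [h₁.iedge_iff v w, .rfl, .rfl, h₂.iedge_iff v w]
  medge_iff := by
    rintro (v | v) (w | w)
    exacts [h₁.medge_iff v w, .rfl, .rfl, h₂.medge_iff v w]
  lab_eq := by
    rintro (v | v)
    exacts [h₁.lab_eq v, h₂.lab_eq v]
  depth_eq := by
    rintro (v | v)
    · exact (depth_sum (.inl _)).trans ((h₁.depth_eq v).trans (depth_sum (.inl v)).symm)
    · exact (depth_sum (.inr _)).trans ((h₂.depth_eq v).trans (depth_sum (.inr v)).symm)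
  rel_iff p v w := by
    rw [rel_sum, rel_sum]
    exact (joinRel_map_map v w).trans (by simp only [h₁.rel_iff, h₂.rel_iff])

theorem arrowMap [Nonempty H₂.V] [Nonempty G₂.V] (h₁ : IsFullEmb f₁) (h₂ : IsFullEmb f₂) :
    IsFullEmb (arrowMap f₁ f₂) where
  injective := (h₁.sumMap h₂).injective
  iedge_iff := by
    rintro (v | v) (w | w)
    exacts [h₁.iedge_iff v w, and_congr h₁.isRoot_iff h₂.isRoot_iff, .rfl, h₂.iedge_iff v w]
  medge_iff := (h₁.sumMap h₂).medge_iff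
  lab_eq := (h₁.sumMap h₂).lab_eq
  depth_eq := by
    rintro (v | v)
    · exact (depth_arrow (.inl _)).trans
        ((congrArg (· + 1) (h₁.depth_eq v)).trans (depth_arrow (.inl v)).symm)
    · exact (depth_arrow (.inr _)).trans ((h₂.depth_eq v).trans (depth_arrow (.inr v)).symm)
  rel_iff p v w := by
    rw [rel_arrow, rel_arrow]
    exact (joinRel_map_map v w).trans (by simp only [h₁.rel_iff, h₂.rel_iff])

theorem squigMap (h₁ : IsFullEmb f₁) (h₂ : IsFullEmb f₂) : IsFullEmb (squigMap f₁ f₂) where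
  injective := (h₁.sumMap h₂).injective
  iedge_iff := (h₁.sumMap h₂).iedge_iff
  medge_iff := by
    rintro (v | v) (w | w)
    exacts [h₁.medge_iff v w, and_congr h₁.isRoot_iff h₂.isRoot_iff, .rfl, h₂.medge_iff v w]
  lab_eq := (h₁.sumMap h₂).lab_eq
  depth_eq v := (depth_squig _).trans ((depth_sum _).symm.trans
    (((h₁.sumMap h₂).depth_eq v).trans ((depth_sum v).trans (depth_squig v).symm)))
  rel_iff p v w := by
    rw [rel_squig, rel_squig]
    exact (joinRel_map_map v w).trans (by simp only [h₁.rel_iff, h₂.rel_iff])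

end IsFullEmb

namespace IsSkewFibration

variable {α : Type*} {H₁ H₂ G₁ G₂ : LGraph α} [H₁.Graded] [H₂.Graded] [G₁.Graded] [G₂.Graded]
  {f₁ : H₁.V → G₁.V} {f₂ : H₂.V → G₂.V} {p : Polarity}

theorem of_sumMap (h : IsSkewFibration p (sumMap f₁ f₂)) :
    IsSkewFibration p f₁ ∧ IsSkewFibration p f₂ := by
  obtain ⟨hmodal, hpres, hlift⟩ := h
  obtain ⟨h₁, h₂⟩ := isModalHom_sumMap_iff.1 hmodal
  rw [rel_sum, rel_sum] at hpres hlift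
  exact ⟨⟨h₁, fun v w => hpres (.inl v) (.inl w), HasSkewLifting.of_sumMap_left hlift⟩,
    ⟨h₂, fun v w => hpres (.inr v) (.inr w), HasSkewLifting.of_sumMap_right hlift⟩⟩

theorem of_arrowMap [Nonempty H₂.V] [Nonempty G₂.V] (h : IsSkewFibration p (arrowMap f₁ f₂)) :
    IsSkewFibration p.flip f₁ ∧ IsSkewFibration p f₂ := by
  obtain ⟨hmodal, hpres, hlift⟩ := h
  obtain ⟨h₁, h₂⟩ := isModalHom_arrowMap_iff.1 hmodal
  rw [rel_arrow, rel_arrow] at hpres hlift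
  exact ⟨⟨h₁, fun v w => hpres (.inl v) (.inl w), HasSkewLifting.of_sumMap_left hlift⟩,
    ⟨h₂, fun v w => hpres (.inr v) (.inr w), HasSkewLifting.of_sumMap_right hlift⟩⟩

theorem of_squigMap {G H K : LGraph α} [G.Graded] [H.Graded] [K.Graded] {f : H.V → G.V}
    (h : IsSkewFibration p (squigMap (H₁ := K) (G₁ := K) id f)) : IsSkewFibration p f := by
  obtain ⟨hmodal, hpres, hlift⟩ := h
  rw [rel_squig, rel_squig] at hpres hlift
  exact ⟨isModalHom_squigMap_iff.1 hmodal, fun v w => hpres (.inr v) (.inr w),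
    HasSkewLifting.of_sumMap_right hlift⟩

theorem of_copair {G : LGraph α} {f₁ : H₁.V → G.V} {f₂ : H₂.V → G.V}
    (h : IsSkewFibration .odd (copair f₁ f₂)) :
    IsSkewFibration .odd f₁ ∧ IsSkewFibration .odd f₂ := by
  obtain ⟨hmodal, hpres, hlift⟩ := h
  obtain ⟨h₁, h₂⟩ := isModalHom_copair_iff.1 hmodal
  rw [rel_sum] at hpres hlift
  refine ⟨⟨h₁, fun v w => hpres (.inl v) (.inl w), fun v w hvw => ?_⟩,
    ⟨h₂, fun v w => hpres (.inr v) (.inr w), fun v w hvw => ?_⟩⟩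
  · obtain ⟨u | u, hvu, huw⟩ := hlift (.inl v) w hvw
    exacts [⟨u, hvu, huw⟩, (nomatch (hvu : Polarity.odd = .even))]
  · obtain ⟨u | u, hvu, huw⟩ := hlift (.inr v) w hvw
    exacts [(nomatch (hvu : Polarity.odd = .even)), ⟨u, hvu, huw⟩]

end IsSkewFibration

end LGraph

namespace LGraph

/-- Modal homomorphisms that preserve the relation of parity `p` and send maximal cliques onto
maximal cliques. Unlike the lifting property of skew fibrations, which it implies, the condition
on maximal cliques is closed under composition. -/
structure IsCliqueMap {α : Type*} (p : Polarity) {H G : LGraph α} (f : H.V → G.V) : Prop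
    extends IsModalHom f where
  preserves : ∀ v w, H.Rel p v w → G.Rel p (f v) (f w)
  maxClique : ∀ K, IsMaxClique (H.Rel p) K → IsMaxClique (G.Rel p) (f '' K)

namespace IsCliqueMap

variable {α : Type*} {G H K H₁ H₂ G₁ G₂ : LGraph α} {p : Polarity}

theorem isSkewFibration {f : H.V → G.V} (hf : IsCliqueMap p f) : IsSkewFibration p f where
  toIsModalHom := hf.toIsModalHom
  preserves := hf.preserves
  lifting :=
    HasSkewLifting.of_image_isMaxClique (fun _ _ => rel_comm.1) (fun _ h => h.ne rfl) hf.maxClique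

theorem comp {f : H.V → K.V} {g : K.V → G.V} (hg : IsCliqueMap p g) (hf : IsCliqueMap p f) :
    IsCliqueMap p (g ∘ f) where
  toIsModalHom := hg.toIsModalHom.comp hf.toIsModalHom
  preserves _ _ h := hg.preserves _ _ (hf.preserves _ _ h)
  maxClique C hC := Set.image_comp g f C ▸ hg.maxClique _ (hf.maxClique C hC)

theorem _root_.LGraph.IsIso.isCliqueMap [G.Graded] {f : H.V → G.V} (hf : IsIso f) :
    IsCliqueMap p f where
  toIsModalHom := hf.isModalHom
  preserves _ _ := (hf.isFullEmb.rel_iff _ _ _).2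
  maxClique _ := IsMaxClique.image_of_bijective hf.bijective (hf.isFullEmb.rel_iff p)

variable [H₁.Graded] [H₂.Graded] [G₁.Graded] [G₂.Graded] [Nonempty H₁.V] [Nonempty H₂.V]
  {f₁ : H₁.V → G₁.V} {f₂ : H₂.V → G₂.V}

theorem sumMap (h₁ : IsCliqueMap p f₁) (h₂ : IsCliqueMap p f₂) :
    IsCliqueMap p (sumMap f₁ f₂) where
  toIsModalHom := isModalHom_sumMap_iff.2 ⟨h₁.toIsModalHom, h₂.toIsModalHom⟩
  preserves v w h := by
    rw [rel_sum] at h ⊢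
    exact (joinRel_map_map v w).2 (joinRel_mono h₁.preserves h₂.preserves v w h)
  maxClique C hC := by
    rw [rel_sum] at hC ⊢
    exact hC.image_sumMap h₁.maxClique h₂.maxClique

theorem arrowMap (h₁ : IsCliqueMap p.flip f₁) (h₂ : IsCliqueMap p f₂) :
    IsCliqueMap p (arrowMap f₁ f₂) := by
  have : Nonempty G₂.V := .map f₂ ‹_›
  refine ⟨h₁.toIsModalHom.arrowMap h₂.toIsModalHom, fun v w h => ?_, fun C hC => ?_⟩
  · rw [rel_arrow] at h ⊢
    exact (joinRel_map_map v w).2 (joinRel_mono h₁.preserves h₂.preserves v w h)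
  · rw [rel_arrow] at hC ⊢
    exact hC.image_sumMap h₁.maxClique h₂.maxClique

theorem squigMap [K.Graded] [Nonempty K.V] (h₂ : IsCliqueMap p f₂) :
    IsCliqueMap p (squigMap (H₁ := K) (G₁ := K) id f₂) where
  toIsModalHom := isModalHom_squigMap_iff.2 h₂.toIsModalHom
  preserves v w h := by
    rw [rel_squig] at h ⊢
    exact (joinRel_map_map v w).2 (joinRel_mono (fun _ _ => id) h₂.preserves v w h)
  maxClique C hC := by
    rw [rel_squig] at hC ⊢
    exact hC.image_sumMap (fun C hC => by rwa [Set.image_id]) h₂.maxClique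

end IsCliqueMap

instance nonempty_single {α : Type*} (l : Label α) : Nonempty (single l).V := ⟨()⟩

section WeakeningContraction

variable {α : Type*} (G H : LGraph α) [G.Graded] [H.Graded] [Nonempty G.V] [Nonempty H.V]

theorem isCliqueMap_sum_inl : IsCliqueMap .odd (H := G) (G := G.sum H) Sum.inl where
  toIsModalHom := isModalHom_sum_inl
  preserves _ _ := (isFullEmb_sum_inl.rel_iff _ _ _).2
  maxClique _ hC := (rel_sum G H .odd).symm ▸ hC.image_sumInl nofun

theorem isCliqueMap_arrow_inr : IsCliqueMap .even (H := H) (G := G.arrow H) Sum.inr where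
  toIsModalHom := isModalHom_arrow_inr
  preserves _ _ := (isFullEmb_arrow_inr.rel_iff _ _ _).2
  maxClique _ hC := (rel_arrow G H .even).symm ▸ hC.image_sumInr nofun

theorem isCliqueMap_squig_inl : IsCliqueMap .odd (H := G) (G := G.squig H) Sum.inl where
  toIsModalHom := isModalHom_squig_inl
  preserves _ _ := (isFullEmb_squig_inl.rel_iff _ _ _).2
  maxClique _ hC := (rel_squig G H .odd).symm ▸ hC.image_sumInl nofun

end WeakeningContraction

theorem isCliqueMap_codiagonal {α : Type*} (G : LGraph α) [G.Graded] [Nonempty G.V] :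
    IsCliqueMap .odd (copair (id : G.V → G.V) id) where
  toIsModalHom :=
    isModalHom_copair_iff.2 ⟨(IsIso.refl G).isModalHom, (IsIso.refl G).isModalHom⟩
  preserves := by
    rw [rel_sum]
    rintro (v | v) (w | w) h
    exacts [h, (nomatch (h : Polarity.odd = .even)), (nomatch (h : Polarity.odd = .even)), h]
  maxClique C hC :=
    IsMaxClique.image_codiagonal (c := Polarity.odd = .even) nofun (rel_sum G G .odd ▸ hC)

end LGraph

open LGraph

namespace Formula

variable {α : Type*}

section Rearrangement

variable (A B C : Formula α)

/-- The isomorphism of arenas for the commutativity of `∧`. -/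
def andComm : (A.and B).arena.V ≃ (B.and A).arena.V := Equiv.sumComm _ _

/-- The isomorphism of arenas for the associativity of `∧`. -/
def andAssoc : ((A.and B).and C).arena.V ≃ (A.and (B.and C)).arena.V := Equiv.sumAssoc _ _ _

/-- The isomorphism of arenas for currying. -/
def impCurry : (imp (A.and B) C).arena.V ≃ (A.imp (B.imp C)).arena.V := Equiv.sumAssoc _ _ _

theorem isIso_andComm : IsIso (andComm A B) where
  bijective := (andComm A B).bijective
  iedge_iff := by rintro (_ | _) (_ | _) <;> exact .rfl
  medge_iff := by rintro (_ | _) (_ | _) <;> exact .rfl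
  lab_eq := by rintro (_ | _) <;> rfl

theorem isIso_andAssoc : IsIso (andAssoc A B C) where
  bijective := (andAssoc A B C).bijective
  iedge_iff := by rintro ((_ | _) | _) ((_ | _) | _) <;> exact .rfl
  medge_iff := by rintro ((_ | _) | _) ((_ | _) | _) <;> exact .rfl
  lab_eq := by rintro ((_ | _) | _) <;> rfl

theorem isIso_impCurry : IsIso (impCurry A B C) where
  bijective := (impCurry A B C).bijective
  iedge_iff := by
    have hA (v) : (A.and B).arena.IsRoot (.inl v) ↔ A.arena.IsRoot v :=
      isLowerEmb_sum_inl.isRoot_iff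
    have hB (v) : (A.and B).arena.IsRoot (.inr v) ↔ B.arena.IsRoot v :=
      isLowerEmb_sum_inr.isRoot_iff
    have hC (v) : (B.imp C).arena.IsRoot (.inr v) ↔ C.arena.IsRoot v :=
      isLowerEmb_arrow_inr.isRoot_iff
    rintro ((v | v) | v) ((w | w) | w)
    exacts [.rfl, iff_of_false (fun h => not_isRoot_arrow_inl w h.2) id,
      and_congr (hA v).symm (hC w), .rfl, .rfl, and_congr (hB v).symm .rfl, .rfl, .rfl, .rfl]
  medge_iff := by rintro ((_ | _) | _) ((_ | _) | _) <;> exact .rfl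
  lab_eq := by rintro ((_ | _) | _) <;> rfl

end Rearrangement

end Formula

open Formula

section Der

variable {α : Type*}

/-- The maps between arenas of formulas that are witnessed by a derivation with the deep weakening
and contraction rules and formula isomorphism. -/
inductive Der : Polarity → (F' F : Formula α) → (F'.arena.V → F.arena.V) → Prop
  | refl (p : Polarity) (F : Formula α) : Der p F F id
  | comp {p : Polarity} {F K G : Formula α} {f : F.arena.V → K.arena.V}
      {g : K.arena.V → G.arena.V} (hf : Der p F K f) (hg : Der p K G g) : Der p F G (g ∘ f)
  | and {p : Polarity} {A A' B B' : Formula α} {f : A.arena.V → A'.arena.V}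
      {g : B.arena.V → B'.arena.V} (hf : Der p A A' f) (hg : Der p B B' g) :
      Der p (A.and B) (A'.and B') (sumMap f g)
  | imp {p : Polarity} {A A' B B' : Formula α} {f : A.arena.V → A'.arena.V}
      {g : B.arena.V → B'.arena.V} (hf : Der p.flip A A' f) (hg : Der p B B' g) :
      Der p (A.imp B) (A'.imp B') (arrowMap f g)
  | box {p : Polarity} {A A' : Formula α} {f : A.arena.V → A'.arena.V} (hf : Der p A A' f) :
      Der p A.box A'.box (squigMap (H₁ := single .box) (G₁ := single .box) id f)
  | dia {p : Polarity} {A A' : Formula α} {f : A.arena.V → A'.arena.V} (hf : Der p A A' f) :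
      Der p A.dia A'.dia (squigMap (H₁ := single .dia) (G₁ := single .dia) id f)
  | comm (p : Polarity) (A B : Formula α) : Der p (A.and B) (B.and A) (andComm A B)
  | assoc (p : Polarity) (A B C : Formula α) :
      Der p ((A.and B).and C) (A.and (B.and C)) (andAssoc A B C)
  | assocSymm (p : Polarity) (A B C : Formula α) :
      Der p (A.and (B.and C)) ((A.and B).and C) (andAssoc A B C).symm
  | curry (p : Polarity) (A B C : Formula α) :
      Der p (.imp (A.and B) C) (A.imp (B.imp C)) (impCurry A B C)
  | currySymm (p : Polarity) (A B C : Formula α) :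
      Der p (A.imp (B.imp C)) (.imp (A.and B) C) (impCurry A B C).symm
  | weakDia (A : Formula α) : Der .odd .diaBot A.dia Sum.inl
  | weakAnd (A B : Formula α) : Der .odd A (A.and B) Sum.inl
  | weakImp (A B : Formula α) : Der .even A (B.imp A) Sum.inr
  | contr (A : Formula α) : Der .odd (A.and A) A (copair (H₁ := A.arena) (H₂ := A.arena) id id)

variable {p : Polarity} {F' F : Formula α} {f : F'.arena.V → F.arena.V}

theorem Der.isCliqueMap (h : Der p F' F f) : IsCliqueMap p f := by
  induction h with
  | refl p F => exact (IsIso.refl _).isCliqueMap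
  | comp _ _ ihf ihg => exact ihg.comp ihf
  | and _ _ ihf ihg => exact ihf.sumMap ihg
  | imp _ _ ihf ihg => exact ihf.arrowMap ihg
  | box _ ih => exact ih.squigMap
  | dia _ ih => exact ih.squigMap
  | comm p A B => exact (isIso_andComm A B).isCliqueMap
  | assoc p A B C => exact (isIso_andAssoc A B C).isCliqueMap
  | assocSymm p A B C => exact (isIso_andAssoc A B C).symm.isCliqueMap
  | curry p A B C => exact (isIso_impCurry A B C).isCliqueMap
  | currySymm p A B C => exact (isIso_impCurry A B C).symm.isCliqueMap
  | weakDia A => exact isCliqueMap_squig_inl (single .dia) A.arena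
  | weakAnd A B => exact isCliqueMap_sum_inl A.arena B.arena
  | weakImp A B => exact isCliqueMap_arrow_inr B.arena A.arena
  | contr A => exact isCliqueMap_codiagonal A.arena

end Der

section Built

variable {α : Type*}

theorem isArena_arena (F : Formula α) : F.arena.IsArena := ⟨F, id, IsIso.refl _⟩

/-- The graph without vertices. -/
def emptyGraph (α : Type*) : LGraph α where
  V := Empty
  iedge _ _ := False
  medge _ _ := False
  lab := Empty.elim

section Empty

variable (G : LGraph α)

theorem isIso_sum_empty : IsIso (H := G) (G := G.sum (emptyGraph α)) Sum.inl where
  bijective := ⟨Sum.inl_injective, Sum.rec (fun v => ⟨v, rfl⟩) Empty.rec⟩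
  iedge_iff _ _ := .rfl
  medge_iff _ _ := .rfl
  lab_eq _ := rfl

theorem isIso_empty_arrow : IsIso (H := G) (G := (emptyGraph α).arrow G) Sum.inr where
  bijective := ⟨Sum.inr_injective, Sum.rec Empty.rec fun v => ⟨v, rfl⟩⟩
  iedge_iff _ _ := .rfl
  medge_iff _ _ := .rfl
  lab_eq _ := rfl

theorem isIso_squig_empty : IsIso (H := G) (G := G.squig (emptyGraph α)) Sum.inl where
  bijective := ⟨Sum.inl_injective, Sum.rec (fun v => ⟨v, rfl⟩) Empty.rec⟩
  iedge_iff _ _ := .rfl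
  medge_iff _ _ := .rfl
  lab_eq _ := rfl

end Empty

variable (p : Polarity) (F : Formula α)

theorem built_empty : Built .odd (H := emptyGraph α) (G := F.arena) Empty.elim :=
  .empty (inferInstanceAs (IsEmpty Empty)) (isArena_arena F)

theorem built_id : Built p (id : F.arena.V → F.arena.V) := .iso (isArena_arena F) (.refl _)

variable {p F}

theorem Der.built {F' : Formula α} {f : F'.arena.V → F.arena.V} (h : Der p F' F f) :
    Built p f := by
  induction h with
  | refl p F => exact built_id p F
  | comp _ _ ihf ihg => exact .comp (isArena_arena _) ihf ihg
  | and _ _ ihf ihg => exact .sum ihf ihg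
  | imp _ _ ihf ihg => exact .arrow ihf ihg inferInstance
  | box _ ih => exact .squig (.inl rfl) ih
  | dia _ ih => exact .squig (.inr rfl) ih
  | comm p A B => exact .iso (isArena_arena _) (isIso_andComm A B)
  | assoc p A B C => exact .iso (isArena_arena _) (isIso_andAssoc A B C)
  | assocSymm p A B C => exact .iso (isArena_arena _) (isIso_andAssoc A B C).symm
  | curry p A B C => exact .iso (isArena_arena _) (isIso_impCurry A B C)
  | currySymm p A B C => exact .iso (isArena_arena _) (isIso_impCurry A B C).symm
  | weakDia A =>
    have hiso := isIso_squig_empty (single (α := α) .dia)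
    exact .comp (K := (single .dia).squig (emptyGraph α)) ⟨.diaBot, _, hiso⟩
      (.iso (isArena_arena .diaBot) hiso) (.squig (.inr rfl) (built_empty A))
  | weakAnd A B =>
    have hiso := isIso_sum_empty A.arena
    exact .comp (K := A.arena.sum (emptyGraph α)) ⟨A, _, hiso⟩
      (.iso (isArena_arena A) hiso) (.sum (built_id _ A) (built_empty B))
  | weakImp A B =>
    have hiso := isIso_empty_arrow A.arena
    exact .comp (K := (emptyGraph α).arrow A.arena) ⟨A, _, hiso⟩ (.iso (isArena_arena A) hiso)
      (.arrow (p := .even) (built_empty B) (built_id _ A) inferInstance)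
  | contr A => exact .copair (built_id _ A) (built_id _ A)

end Built

namespace PFormula

section Derives

variable {α : Type*} {p p' : Polarity}

theorem Derives.congr (φ : PFormula α p → PFormula α p') (c : ∀ q, Ctx α q p → Ctx α q p')
    (hc : ∀ q (C : Ctx α q p) X, (c q C).fill X = φ (C.fill X)) {X Y : PFormula α p}
    (h : Derives X Y) : Derives (φ X) (φ Y) := by
  refine Relation.ReflTransGen.lift φ ?_ X Y h
  rintro X Y (⟨q, C, A', A, hr, rfl, rfl⟩ | h)
  · exact .inl ⟨q, c q C, A', A, hr, (hc _ _ _).symm, (hc _ _ _).symm⟩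
  · right
    induction h with
    | rel X Y h =>
      obtain ⟨q, C, A, B, hr, rfl, rfl⟩ := h
      exact .rel _ _ ⟨q, c q C, A, B, hr, (hc _ _ _).symm, (hc _ _ _).symm⟩
    | refl X => exact .refl _
    | symm _ _ _ ih => exact .symm _ _ ih
    | trans _ _ _ _ _ ih₁ ih₂ => exact .trans _ _ _ ih₁ ih₂

theorem Derives.of_rule {X Y : PFormula α p} (h : Rule X Y) : Derives X Y :=
  .single (.inl ⟨p, .hole, X, Y, h, rfl, rfl⟩)

theorem Derives.of_isoRule {X Y : PFormula α p} (h : IsoRule X Y) : Derives X Y :=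
  .single (.inr (.rel _ _ ⟨p, .hole, X, Y, h, rfl, rfl⟩))

theorem Derives.of_isoRule_symm {X Y : PFormula α p} (h : IsoRule X Y) : Derives Y X :=
  .single (.inr (.symm _ _ (.rel _ _ ⟨p, .hole, X, Y, h, rfl, rfl⟩)))

theorem Derives.tensor {A A' B B' : PFormula α p} (hA : Derives A A') (hB : Derives B B') :
    Derives (tensor A B) (tensor A' B') :=
  (hA.congr (PFormula.tensor · B) (fun _ C => .tensorL C B) fun _ _ _ => rfl).trans
    (hB.congr (PFormula.tensor A' ·) (fun _ C => .tensorR A' C) fun _ _ _ => rfl)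

theorem Derives.limp {A A' : PFormula α p.flip} {B B' : PFormula α p} (hA : Derives A A')
    (hB : Derives B B') : Derives (limp A B) (limp A' B') :=
  (hA.congr (PFormula.limp · B) (fun _ C => .limpL C B) fun _ _ _ => rfl).trans
    (hB.congr (PFormula.limp A' ·) (fun _ C => .limpR A' C) fun _ _ _ => rfl)

theorem Derives.box {A A' : PFormula α p} (h : Derives A A') : Derives (box A) (box A') :=
  h.congr PFormula.box (fun _ C => .box C) fun _ _ _ => rfl

theorem Derives.dia {A A' : PFormula α p} (h : Derives A A') : Derives (dia A) (dia A') :=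
  h.congr PFormula.dia (fun _ C => .dia C) fun _ _ _ => rfl

end Derives

section Erase

variable {α : Type*} {p : Polarity} {H : PFormula α p} {A B : Formula α}

theorem erase_injective : Function.Injective (erase : PFormula α p → Formula α) := by
  intro X
  induction X with
  | atom a => intro Y h; cases Y <;> simp_all [erase]
  | tensor A B ihA ihB =>
    intro Y h
    cases Y <;> simp only [erase, Formula.and.injEq, reduceCtorEq] at h
    rw [ihA h.1, ihB h.2]
  | limp A B ihA ihB =>
    intro Y h
    cases Y <;> simp only [erase, Formula.imp.injEq, reduceCtorEq] at h
    rw [ihA h.1, ihB h.2]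
  | box A ih =>
    intro Y h
    cases Y <;> simp only [erase, Formula.box.injEq, reduceCtorEq] at h
    rw [ih h]
  | dia A ih =>
    intro Y h
    cases Y <;> simp only [erase, Formula.dia.injEq, reduceCtorEq] at h
    rw [ih h]
  | diaBot => intro Y h; cases Y <;> simp_all [erase]

theorem exists_tensor_of_erase_eq_and (h : H.erase = A.and B) :
    ∃ A' B', H = tensor A' B' ∧ A'.erase = A ∧ B'.erase = B := by
  cases H <;> simp only [erase, Formula.and.injEq, reduceCtorEq] at h
  exact ⟨_, _, rfl, h⟩

theorem exists_limp_of_erase_eq_imp (h : H.erase = A.imp B) :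
    ∃ A' B', H = limp A' B' ∧ A'.erase = A ∧ B'.erase = B := by
  cases H <;> simp only [erase, Formula.imp.injEq, reduceCtorEq] at h
  exact ⟨_, _, rfl, h⟩

theorem exists_box_of_erase_eq_box (h : H.erase = A.box) : ∃ A', H = box A' ∧ A'.erase = A := by
  cases H <;> simp only [erase, Formula.box.injEq, reduceCtorEq] at h
  exact ⟨_, rfl, h⟩

theorem exists_dia_of_erase_eq_dia (h : H.erase = A.dia) : ∃ A', H = dia A' ∧ A'.erase = A := by
  cases H <;> simp only [erase, Formula.dia.injEq, reduceCtorEq] at h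
  exact ⟨_, rfl, h⟩

end Erase

/-- Every polarization of `F` with polarity `p` is derivable from some polarization of `F'`: the
form in which derivations are read off from `Der`, which does not mention polarized formulas. -/
def DerivesErased {α : Type*} (p : Polarity) (F' F : Formula α) : Prop :=
  ∀ H : PFormula α p, H.erase = F → ∃ H' : PFormula α p, H'.erase = F' ∧ Derives H' H

namespace DerivesErased

variable {α : Type*} {p : Polarity} {F K G A A' B B' : Formula α}

theorem trans (h₁ : DerivesErased p F K) (h₂ : DerivesErased p K G) : DerivesErased p F G := by
  intro H hH
  obtain ⟨X, hX, dX⟩ := h₂ H hH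
  obtain ⟨Y, hY, dY⟩ := h₁ X hX
  exact ⟨Y, hY, dY.trans dX⟩

theorem and (hA : DerivesErased p A A') (hB : DerivesErased p B B') :
    DerivesErased p (A.and B) (A'.and B') := by
  intro H hH
  obtain ⟨X, Y, rfl, hX, hY⟩ := exists_tensor_of_erase_eq_and hH
  obtain ⟨X', rfl, dX⟩ := hA X hX
  obtain ⟨Y', rfl, dY⟩ := hB Y hY
  exact ⟨_, rfl, dX.tensor dY⟩

theorem imp (hA : DerivesErased p.flip A A') (hB : DerivesErased p B B') :
    DerivesErased p (A.imp B) (A'.imp B') := by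
  intro H hH
  obtain ⟨X, Y, rfl, hX, hY⟩ := exists_limp_of_erase_eq_imp hH
  obtain ⟨X', rfl, dX⟩ := hA X hX
  obtain ⟨Y', rfl, dY⟩ := hB Y hY
  exact ⟨_, rfl, dX.limp dY⟩

theorem box (hA : DerivesErased p A A') : DerivesErased p A.box A'.box := by
  intro H hH
  obtain ⟨X, rfl, hX⟩ := exists_box_of_erase_eq_box hH
  obtain ⟨X', rfl, dX⟩ := hA X hX
  exact ⟨_, rfl, dX.box⟩

theorem dia (hA : DerivesErased p A A') : DerivesErased p A.dia A'.dia := by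
  intro H hH
  obtain ⟨X, rfl, hX⟩ := exists_dia_of_erase_eq_dia hH
  obtain ⟨X', rfl, dX⟩ := hA X hX
  exact ⟨_, rfl, dX.dia⟩

theorem and_comm (p : Polarity) (A B : Formula α) : DerivesErased p (A.and B) (B.and A) := by
  intro H hH
  obtain ⟨Y, X, rfl, rfl, rfl⟩ := exists_tensor_of_erase_eq_and hH
  exact ⟨_, rfl, .of_isoRule (.comm X Y)⟩

theorem and_assoc (p : Polarity) (A B C : Formula α) :
    DerivesErased p ((A.and B).and C) (A.and (B.and C)) := by
  intro H hH
  obtain ⟨X, YZ, rfl, rfl, hYZ⟩ := exists_tensor_of_erase_eq_and hH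
  obtain ⟨Y, Z, rfl, rfl, rfl⟩ := exists_tensor_of_erase_eq_and hYZ
  exact ⟨_, rfl, .of_isoRule_symm (.assoc X Y Z)⟩

theorem and_assoc_symm (p : Polarity) (A B C : Formula α) :
    DerivesErased p (A.and (B.and C)) ((A.and B).and C) := by
  intro H hH
  obtain ⟨XY, Z, rfl, hXY, rfl⟩ := exists_tensor_of_erase_eq_and hH
  obtain ⟨X, Y, rfl, rfl, rfl⟩ := exists_tensor_of_erase_eq_and hXY
  exact ⟨_, rfl, .of_isoRule (.assoc X Y Z)⟩

theorem imp_curry (p : Polarity) (A B C : Formula α) :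
    DerivesErased p (.imp (A.and B) C) (A.imp (B.imp C)) := by
  intro H hH
  obtain ⟨X, YZ, rfl, rfl, hYZ⟩ := exists_limp_of_erase_eq_imp hH
  obtain ⟨Y, Z, rfl, rfl, rfl⟩ := exists_limp_of_erase_eq_imp hYZ
  exact ⟨_, rfl, .of_isoRule (.curry X Y Z)⟩

theorem imp_curry_symm (p : Polarity) (A B C : Formula α) :
    DerivesErased p (A.imp (B.imp C)) (.imp (A.and B) C) := by
  intro H hH
  obtain ⟨XY, Z, rfl, hXY, rfl⟩ := exists_limp_of_erase_eq_imp hH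
  obtain ⟨X, Y, rfl, rfl, rfl⟩ := exists_tensor_of_erase_eq_and hXY
  exact ⟨_, rfl, .of_isoRule_symm (.curry X Y Z)⟩

theorem diaBot_dia (A : Formula α) : DerivesErased .odd .diaBot A.dia := by
  intro H hH
  obtain ⟨X, rfl, rfl⟩ := exists_dia_of_erase_eq_dia hH
  exact ⟨_, rfl, .of_rule (.weakDia X)⟩

theorem and_left (A B : Formula α) : DerivesErased .odd A (A.and B) := by
  intro H hH
  obtain ⟨X, Y, rfl, rfl, rfl⟩ := exists_tensor_of_erase_eq_and hH
  exact ⟨_, rfl, .of_rule (.weakTensor X Y)⟩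

theorem imp_right (A B : Formula α) : DerivesErased .even A (B.imp A) := by
  intro H hH
  obtain ⟨Y, X, rfl, rfl, rfl⟩ := exists_limp_of_erase_eq_imp hH
  exact ⟨_, rfl, .of_rule (.weakLimp X Y)⟩

theorem and_self (A : Formula α) : DerivesErased .odd (A.and A) A := by
  rintro H rfl
  exact ⟨_, rfl, .of_rule (.contr H)⟩

theorem of_der {F' F : Formula α} {f : F'.arena.V → F.arena.V} (h : Der p F' F f) :
    DerivesErased p F' F := by
  induction h with
  | refl p F => exact fun H hH => ⟨H, hH, .refl⟩
  | comp _ _ ihf ihg => exact ihf.trans ihg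
  | and _ _ ihf ihg => exact ihf.and ihg
  | imp _ _ ihf ihg => exact ihf.imp ihg
  | box _ ih => exact ih.box
  | dia _ ih => exact ih.dia
  | comm p A B => exact and_comm p A B
  | assoc p A B C => exact and_assoc p A B C
  | assocSymm p A B C => exact and_assoc_symm p A B C
  | curry p A B C => exact imp_curry p A B C
  | currySymm p A B C => exact imp_curry_symm p A B C
  | weakDia A => exact diaBot_dia A
  | weakAnd A B => exact and_left A B
  | weakImp A B => exact imp_right A B
  | contr A => exact and_self A

end DerivesErased

section ExistsDer

variable {α : Type*} {p q : Polarity} {X Y : PFormula α q}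

theorem Derives.of_der {f : X.arena.V → Y.arena.V} (h : Der q X.erase Y.erase f) :
    Derives X Y := by
  obtain ⟨Z, hZ, hderives⟩ := DerivesErased.of_der h Y rfl
  rwa [erase_injective hZ] at hderives

theorem exists_der_fill (C : Ctx α q p) (h : ∃ f, Der q X.erase Y.erase f) :
    ∃ f, Der p (C.fill X).erase (C.fill Y).erase f := by
  induction C with
  | hole => exact h
  | tensorL C B ih => obtain ⟨f, hf⟩ := ih; exact ⟨_, .and hf (.refl _ _)⟩
  | tensorR A C ih => obtain ⟨f, hf⟩ := ih; exact ⟨_, .and (.refl _ _) hf⟩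
  | limpL C B ih => obtain ⟨f, hf⟩ := ih; exact ⟨_, .imp hf (.refl _ _)⟩
  | limpR A C ih => obtain ⟨f, hf⟩ := ih; exact ⟨_, .imp (.refl _ _) hf⟩
  | box C ih => obtain ⟨f, hf⟩ := ih; exact ⟨_, .box hf⟩
  | dia C ih => obtain ⟨f, hf⟩ := ih; exact ⟨_, .dia hf⟩

theorem Rule.exists_der (h : Rule X Y) : ∃ f, Der q X.erase Y.erase f := by
  cases h with
  | weakDia A => exact ⟨_, .weakDia _⟩
  | weakTensor A B => exact ⟨_, .weakAnd _ _⟩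
  | weakLimp A B => exact ⟨_, .weakImp _ _⟩
  | contr A => exact ⟨_, .contr _⟩

theorem IsoRule.exists_der (h : IsoRule X Y) :
    (∃ f, Der q X.erase Y.erase f) ∧ ∃ f, Der q Y.erase X.erase f := by
  cases h with
  | comm A B => exact ⟨⟨_, .comm _ _ _⟩, ⟨_, .comm _ _ _⟩⟩
  | assoc A B C => exact ⟨⟨_, .assocSymm _ _ _ _⟩, ⟨_, .assoc _ _ _ _⟩⟩
  | curry A B C => exact ⟨⟨_, .curry _ _ _ _⟩, ⟨_, .currySymm _ _ _ _⟩⟩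

theorem FormulaIso.exists_der (h : FormulaIso X Y) :
    (∃ f, Der q X.erase Y.erase f) ∧ ∃ f, Der q Y.erase X.erase f := by
  induction h with
  | rel X Y h =>
    obtain ⟨q, C, A, B, hAB, rfl, rfl⟩ := h
    exact hAB.exists_der.imp (exists_der_fill C) (exists_der_fill C)
  | refl X => exact ⟨⟨_, .refl _ _⟩, ⟨_, .refl _ _⟩⟩
  | symm _ _ _ ih => exact ih.symm
  | trans _ _ _ _ _ ih₁ ih₂ =>
    obtain ⟨⟨f, hf⟩, ⟨f', hf'⟩⟩ := ih₁
    obtain ⟨⟨g, hg⟩, ⟨g', hg'⟩⟩ := ih₂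
    exact ⟨⟨_, .comp hf hg⟩, ⟨_, .comp hg' hf'⟩⟩

theorem Derives.exists_der (h : Derives X Y) : ∃ f, Der q X.erase Y.erase f := by
  induction h with
  | refl => exact ⟨_, .refl _ _⟩
  | @tail Y Z _ h ih =>
    obtain ⟨f, hf⟩ := ih
    obtain ⟨g, hg⟩ : ∃ g, Der q Y.erase Z.erase g := by
      rcases h with ⟨q, C, A', A, hr, rfl, rfl⟩ | h
      · exact exists_der_fill C hr.exists_der
      · exact (FormulaIso.exists_der h).1
    exact ⟨_, .comp hf hg⟩

end ExistsDer

end PFormula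

section LiftingSet

variable {V W : Type*} {R : V → V → Prop} {R' : W → W → Prop} {c : Prop}

/-- The lifting property of skew fibrations, in terms of the range `S` of the map only. -/
def IsLiftingSet (R : V → V → Prop) (S : Set V) : Prop :=
  ∀ v ∈ S, ∀ w, R v w → ∃ u ∈ S, R v u ∧ ¬ R u w

namespace IsLiftingSet

variable {S : Set (V ⊕ W)} (hS : IsLiftingSet (joinRel c R R') S)
include hS

theorem preimage_inl : IsLiftingSet R (Sum.inl ⁻¹' S) := by
  intro v hv w hvw
  obtain ⟨u | u, hu, hvu, huw⟩ := hS (.inl v) hv (.inl w) hvw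
  exacts [⟨u, hu, hvu, huw⟩, (huw hvu).elim]

theorem preimage_inr : IsLiftingSet R' (Sum.inr ⁻¹' S) := by
  intro v hv w hvw
  obtain ⟨u | u, hu, hvu, huw⟩ := hS (.inr v) hv (.inr w) hvw
  exacts [(huw hvu).elim, ⟨u, hu, hvu, huw⟩]

theorem nonempty_preimage_inr [Nonempty W] (hc : c) (h : (Sum.inl ⁻¹' S).Nonempty) :
    (Sum.inr ⁻¹' S).Nonempty := by
  obtain ⟨v, hv⟩ := h
  obtain ⟨u | u, hu, -, huw⟩ := hS (.inl v) hv (.inr (Classical.arbitrary W)) hc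
  exacts [(huw hc).elim, ⟨u, hu⟩]

theorem nonempty_preimage_inl [Nonempty V] (hc : c) (h : (Sum.inr ⁻¹' S).Nonempty) :
    (Sum.inl ⁻¹' S).Nonempty := by
  obtain ⟨v, hv⟩ := h
  obtain ⟨u | u, hu, -, huw⟩ := hS (.inr v) hv (.inl (Classical.arbitrary V)) hc
  exacts [⟨u, hu⟩, (huw hc).elim]

end IsLiftingSet

end LiftingSet

namespace LGraph

variable {α : Type*}

/-- The properties of the range of a skew fibration from the arena of a formula that make it the
range of a derivation. -/
structure IsSkewSet (p : Polarity) (G : LGraph α) (S : Set G.V) : Prop where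
  lifting : IsLiftingSet (G.Rel p) S
  mem_of_medge : ∀ {v w}, w ∈ S → G.medge v w → v ∈ S
  exists_iedge : ∀ v ∈ S, ¬ G.IsRoot v → ∃ w ∈ S, G.iedge v w
  exists_medge_of_box : ∀ v ∈ S, G.lab v = .box → ∃ w ∈ S, G.medge v w

namespace IsSkewSet

variable {G H K : LGraph α} {p q : Polarity}

theorem exists_isRoot [G.Graded] {S : Set G.V} (hS : IsSkewSet p G S) (hne : S.Nonempty) :
    ∃ r ∈ S, G.IsRoot r := by
  obtain ⟨v, hv⟩ := hne
  induction h : G.depth v generalizing v with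
  | zero => exact ⟨v, hv, isRoot_iff_depth_eq_zero.2 h⟩
  | succ n ih =>
    obtain ⟨w, hw, hvw⟩ := hS.exists_iedge v hv (by rw [isRoot_iff_depth_eq_zero]; omega)
    exact ih w hw (by have := depth_of_iedge hvw; omega)

theorem preimage {S : Set K.V} (hS : IsSkewSet p K S) {e : G.V → K.V}
    (hlift : IsLiftingSet (G.Rel q) (e ⁻¹' S))
    (hiedge : ∀ v, ¬ G.IsRoot v → ∀ x, K.iedge (e v) x ↔ ∃ w, G.iedge v w ∧ e w = x)
    (hmedge : ∀ v x, K.medge (e v) x ↔ ∃ w, G.medge v w ∧ e w = x)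
    (hlab : ∀ v, K.lab (e v) = G.lab v) : IsSkewSet q G (e ⁻¹' S) where
  lifting := hlift
  mem_of_medge hw hvw := hS.mem_of_medge hw ((hmedge _ _).2 ⟨_, hvw, rfl⟩)
  exists_iedge v hv hroot := by
    have hroot' : ¬ K.IsRoot (e v) := by
      obtain ⟨w, hvw⟩ := not_forall_not.1 hroot
      exact fun h => h _ ((hiedge v hroot _).2 ⟨w, hvw, rfl⟩)
    obtain ⟨_, hx, hvx⟩ := hS.exists_iedge (e v) hv hroot'
    obtain ⟨w, hvw, rfl⟩ := (hiedge v hroot _).1 hvx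
    exact ⟨w, hx, hvw⟩
  exists_medge_of_box v hv hbox := by
    obtain ⟨_, hx, hvx⟩ := hS.exists_medge_of_box (e v) hv ((hlab v).trans hbox)
    obtain ⟨w, hvw, rfl⟩ := (hmedge _ _).1 hvx
    exact ⟨w, hx, hvw⟩

variable [G.Graded] [H.Graded]

theorem sum_inl {S : Set (G.sum H).V} (hS : IsSkewSet p (G.sum H) S) :
    IsSkewSet p G (Sum.inl ⁻¹' S) :=
  hS.preimage (rel_sum G H p ▸ hS.lifting).preimage_inl
    (fun v _ => isLowerEmb_sum_inl.iedge_iff v) (by rintro v (x | x) <;> simp [sum]) fun _ => rfl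

theorem sum_inr {S : Set (G.sum H).V} (hS : IsSkewSet p (G.sum H) S) :
    IsSkewSet p H (Sum.inr ⁻¹' S) :=
  hS.preimage (rel_sum G H p ▸ hS.lifting).preimage_inr
    (fun v _ => isLowerEmb_sum_inr.iedge_iff v) (by rintro v (x | x) <;> simp [sum]) fun _ => rfl

theorem arrow_inl [Nonempty H.V] {S : Set (G.arrow H).V} (hS : IsSkewSet p (G.arrow H) S) :
    IsSkewSet p.flip G (Sum.inl ⁻¹' S) :=
  hS.preimage (rel_arrow G H p ▸ hS.lifting).preimage_inl
    (fun v hv => by rintro (x | x) <;> simp [arrow, hv]) (by rintro v (x | x) <;> simp [arrow])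
    fun _ => rfl

theorem arrow_inr [Nonempty H.V] {S : Set (G.arrow H).V} (hS : IsSkewSet p (G.arrow H) S) :
    IsSkewSet p H (Sum.inr ⁻¹' S) :=
  hS.preimage (rel_arrow G H p ▸ hS.lifting).preimage_inr
    (fun v _ => isLowerEmb_arrow_inr.iedge_iff v) (by rintro v (x | x) <;> simp [arrow])
    fun _ => rfl

theorem squig_inr {S : Set (G.squig H).V} (hS : IsSkewSet p (G.squig H) S) :
    IsSkewSet p H (Sum.inr ⁻¹' S) :=
  hS.preimage (rel_squig G H p ▸ hS.lifting).preimage_inr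
    (fun v _ => isLowerEmb_sum_inr.iedge_iff v) (by rintro v (x | x) <;> simp [squig])
    fun _ => rfl

theorem squig_single_inl {l : Label α} {S : Set ((single l).squig H).V}
    (hS : IsSkewSet p ((single l).squig H) S) (hne : S.Nonempty) : Sum.inl ⁻¹' S = Set.univ := by
  refine Set.eq_univ_of_forall fun _ => ?_
  obtain ⟨v | v, hv⟩ := hne
  · exact hv
  · obtain ⟨r, hr, hroot⟩ := hS.squig_inr.exists_isRoot ⟨v, hv⟩
    exact hS.mem_of_medge (v := .inl ()) hr ⟨fun _ => id, hroot⟩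

end IsSkewSet

end LGraph

/-- `S` is the range of an embedding that is witnessed by a derivation. -/
def IsDerRange {α : Type*} (p : Polarity) (F : Formula α) (S : Set F.arena.V) : Prop :=
  ∃ (F' : Formula α) (g : F'.arena.V → F.arena.V), Der p F' F g ∧ IsFullEmb g ∧ Set.range g = S

theorem range_sumMap_of_preimage {V W V' W' : Type*} {f : V → V'} {g : W → W'}
    {S : Set (V' ⊕ W')} (hf : Set.range f = Sum.inl ⁻¹' S) (hg : Set.range g = Sum.inr ⁻¹' S) :
    Set.range (Sum.map f g) = S := by
  rw [Sum.map, Set.Sum.elim_range, Set.range_comp, Set.range_comp, hf, hg,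
    Set.image_preimage_inl_union_image_preimage_inr]

section DerRange

variable {α : Type*} {p : Polarity} {A B F K : Formula α}

namespace IsDerRange

theorem univ : IsDerRange p F Set.univ :=
  ⟨F, id, .refl p F, (IsIso.refl _).isFullEmb, Set.range_id⟩

theorem image {S : Set K.arena.V} (hS : IsDerRange p K S) {g : K.arena.V → F.arena.V}
    (hg : Der p K F g) (he : IsFullEmb g) : IsDerRange p F (g '' S) := by
  obtain ⟨F', f, hf, hef, rfl⟩ := hS
  exact ⟨F', g ∘ f, .comp hf hg, he.comp hef, Set.range_comp g f⟩

theorem and {S : Set (A.and B).arena.V} (hA : IsDerRange p A (Sum.inl ⁻¹' S))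
    (hB : IsDerRange p B (Sum.inr ⁻¹' S)) : IsDerRange p (A.and B) S := by
  obtain ⟨A', f, hf, hef, hrf⟩ := hA
  obtain ⟨B', g, hg, heg, hrg⟩ := hB
  exact ⟨_, _, .and hf hg, hef.sumMap heg, range_sumMap_of_preimage hrf hrg⟩

theorem imp {S : Set (A.imp B).arena.V} (hA : IsDerRange p.flip A (Sum.inl ⁻¹' S))
    (hB : IsDerRange p B (Sum.inr ⁻¹' S)) : IsDerRange p (A.imp B) S := by
  obtain ⟨A', f, hf, hef, hrf⟩ := hA
  obtain ⟨B', g, hg, heg, hrg⟩ := hB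
  exact ⟨_, _, .imp hf hg, hef.arrowMap heg, range_sumMap_of_preimage hrf hrg⟩

theorem box {S : Set A.box.arena.V} (hl : Sum.inl ⁻¹' S = Set.univ)
    (hA : IsDerRange p A (Sum.inr ⁻¹' S)) : IsDerRange p A.box S := by
  obtain ⟨A', f, hf, hef, hrf⟩ := hA
  exact ⟨_, _, .box hf, (IsIso.refl _).isFullEmb.squigMap hef,
    range_sumMap_of_preimage (Set.range_id.trans hl.symm) hrf⟩

theorem dia {S : Set A.dia.arena.V} (hl : Sum.inl ⁻¹' S = Set.univ)
    (hA : IsDerRange p A (Sum.inr ⁻¹' S)) : IsDerRange p A.dia S := by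
  obtain ⟨A', f, hf, hef, hrf⟩ := hA
  exact ⟨_, _, .dia hf, (IsIso.refl _).isFullEmb.squigMap hef,
    range_sumMap_of_preimage (Set.range_id.trans hl.symm) hrf⟩

end IsDerRange

namespace LGraph.IsSkewSet

theorem isDerRange_and {S : Set (A.and B).arena.V} (hS : IsSkewSet p (A.and B).arena S)
    (hne : S.Nonempty) (hA : (Sum.inl ⁻¹' S).Nonempty → IsDerRange p A (Sum.inl ⁻¹' S))
    (hB : (Sum.inr ⁻¹' S).Nonempty → IsDerRange p B (Sum.inr ⁻¹' S)) :
    IsDerRange p (A.and B) S := by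
  have hlift : IsLiftingSet (joinRel (p = .even) _ _) S := rel_sum A.arena B.arena p ▸ hS.lifting
  have hunion := Set.image_preimage_inl_union_image_preimage_inr S
  rcases (Sum.inl ⁻¹' S).eq_empty_or_nonempty with hl | hl <;>
    rcases (Sum.inr ⁻¹' S).eq_empty_or_nonempty with hr | hr
  · rw [hl, hr, Set.image_empty, Set.image_empty, Set.union_empty] at hunion
    exact (hne.ne_empty hunion.symm).elim
  · cases p
    · exact ((hlift.nonempty_preimage_inl rfl hr).ne_empty hl).elim
    · rw [hl, Set.image_empty, Set.empty_union] at hunion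
      have hweak : Der .odd B (A.and B) Sum.inr := (Der.weakAnd B A).comp (Der.comm .odd B A)
      exact hunion ▸ (hB hr).image hweak isFullEmb_sum_inr
  · cases p
    · exact ((hlift.nonempty_preimage_inr rfl hl).ne_empty hr).elim
    · rw [hr, Set.image_empty, Set.union_empty] at hunion
      exact hunion ▸ (hA hl).image (.weakAnd A B) isFullEmb_sum_inl
  · exact (hA hl).and (hB hr)

theorem isDerRange_imp {S : Set (A.imp B).arena.V} (hS : IsSkewSet p (A.imp B).arena S)
    (hne : S.Nonempty) (hA : (Sum.inl ⁻¹' S).Nonempty → IsDerRange p.flip A (Sum.inl ⁻¹' S))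
    (hB : (Sum.inr ⁻¹' S).Nonempty → IsDerRange p B (Sum.inr ⁻¹' S)) :
    IsDerRange p (A.imp B) S := by
  have hlift : IsLiftingSet (joinRel (p = .odd) _ _) S := rel_arrow A.arena B.arena p ▸ hS.lifting
  have hr : (Sum.inr ⁻¹' S).Nonempty := by
    obtain ⟨r | r, hr, hroot⟩ := hS.exists_isRoot hne
    exacts [(not_isRoot_arrow_inl r hroot).elim, ⟨r, hr⟩]
  rcases (Sum.inl ⁻¹' S).eq_empty_or_nonempty with hl | hl
  · cases p
    · have hunion := Set.image_preimage_inl_union_image_preimage_inr S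
      rw [hl, Set.image_empty, Set.empty_union] at hunion
      exact hunion ▸ (hB hr).image (.weakImp B A) isFullEmb_arrow_inr
    · exact ((hlift.nonempty_preimage_inl rfl hr).ne_empty hl).elim
  · exact (hA hl).imp (hB hr)

theorem isDerRange_box {S : Set A.box.arena.V} (hS : IsSkewSet p A.box.arena S)
    (hne : S.Nonempty) (hA : (Sum.inr ⁻¹' S).Nonempty → IsDerRange p A (Sum.inr ⁻¹' S)) :
    IsDerRange p A.box S := by
  have hl : Sum.inl ⁻¹' S = Set.univ := hS.squig_single_inl hne
  obtain ⟨w | w, hw, hedge⟩ := hS.exists_medge_of_box (.inl ()) (hl.ge trivial) rfl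
  exacts [hedge.elim, .box hl (hA ⟨w, hw⟩)]

theorem isDerRange_dia {S : Set A.dia.arena.V} (hS : IsSkewSet p A.dia.arena S)
    (hne : S.Nonempty) (hA : (Sum.inr ⁻¹' S).Nonempty → IsDerRange p A (Sum.inr ⁻¹' S)) :
    IsDerRange p A.dia S := by
  have hl : Sum.inl ⁻¹' S = Set.univ := hS.squig_single_inl hne
  rcases (Sum.inr ⁻¹' S).eq_empty_or_nonempty with hr | hr
  · cases p
    · have hlift := rel_squig (single .dia) A.arena .even ▸ hS.lifting
      exact ((hlift.nonempty_preimage_inr rfl ⟨(), hl.ge trivial⟩).ne_empty hr).elim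
    · have hunion := Set.image_preimage_inl_union_image_preimage_inr S
      rw [hl, hr, Set.image_empty, Set.union_empty] at hunion
      exact hunion ▸ IsDerRange.univ.image (.weakDia A) isFullEmb_squig_inl
  · exact .dia hl (hA hr)

theorem isDerRange {S : Set F.arena.V} (hS : IsSkewSet p F.arena S) (hne : S.Nonempty) :
    IsDerRange p F S := by
  induction F generalizing p with
  | atom a => exact (Subsingleton.eq_univ_of_nonempty (α := Unit) hne) ▸ .univ
  | diaBot => exact (Subsingleton.eq_univ_of_nonempty (α := Unit) hne) ▸ .univ
  | and A B ihA ihB => exact hS.isDerRange_and hne (ihA hS.sum_inl) (ihB hS.sum_inr)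
  | imp A B ihA ihB => exact hS.isDerRange_imp hne (ihA hS.arrow_inl) (ihB hS.arrow_inr)
  | box A ih => exact hS.isDerRange_box hne (ih hS.squig_inr)
  | dia A ih => exact hS.isDerRange_dia hne (ih hS.squig_inr)

end LGraph.IsSkewSet

theorem Formula.exists_medge_of_lab_eq_box {v : F.arena.V} (hv : F.arena.lab v = .box) :
    ∃ w, F.arena.medge v w := by
  induction F with
  | atom a => cases hv
  | diaBot => cases hv
  | and A B ihA ihB =>
    rcases v with v | v
    exacts [(ihA hv).imp' Sum.inl fun _ => id, (ihB hv).imp' Sum.inr fun _ => id]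
  | imp A B ihA ihB =>
    rcases v with v | v
    exacts [(ihA hv).imp' Sum.inl fun _ => id, (ihB hv).imp' Sum.inr fun _ => id]
  | box A ih =>
    rcases v with v | v
    · exact (exists_isRoot A.arena).imp' Sum.inr fun _ hr => ⟨fun _ => id, hr⟩
    · exact (ih hv).imp' Sum.inr fun _ => id
  | dia A ih =>
    rcases v with v | v
    · cases hv
    · exact (ih hv).imp' Sum.inr fun _ => id

namespace LGraph.IsSkewFibration

theorem isSkewSet_range {F' : Formula α} {G : LGraph α} [G.Graded] {f : F'.arena.V → G.V}
    (hf : IsSkewFibration p f) : IsSkewSet p G (Set.range f) where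
  lifting := by
    rintro _ ⟨v, rfl⟩ w hvw
    obtain ⟨u, hvu, huw⟩ := hf.lifting v w hvw
    exact ⟨f u, ⟨u, rfl⟩, hf.preserves _ _ hvu, huw⟩
  mem_of_medge := by
    rintro v _ ⟨u, rfl⟩ hvu
    obtain ⟨w, -, hw⟩ := hf.modal v u hvu
    exact ⟨w, hw⟩
  exists_iedge := by
    rintro _ ⟨v, rfl⟩ hroot
    obtain ⟨w, hvw⟩ := not_forall_not.1 (hf.isRoot_iff.not.1 hroot)
    exact ⟨f w, ⟨w, rfl⟩, hf.iedge _ _ hvw⟩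
  exists_medge_of_box := by
    rintro _ ⟨v, rfl⟩ hbox
    obtain ⟨w, hvw⟩ := exists_medge_of_lab_eq_box ((hf.lab v).trans hbox)
    exact ⟨f w, ⟨w, rfl⟩, hf.medge _ _ hvw⟩

theorem exists_surjective {F' : Formula α} {f : F'.arena.V → F.arena.V}
    (hf : IsSkewFibration p f) :
    ∃ (K : Formula α) (f' : F'.arena.V → K.arena.V) (g : K.arena.V → F.arena.V),
      Der p K F g ∧ IsSkewFibration p f' ∧ Function.Surjective f' ∧ g ∘ f' = f := by
  obtain ⟨K, g, hg, he, hrange⟩ := hf.isSkewSet_range.isDerRange (Set.range_nonempty f)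
  choose f' hf' using fun v => hrange.ge ⟨v, rfl⟩
  have hcomp : g ∘ f' = f := funext hf'
  refine ⟨K, f', g, hg, he.isSkewFibration_of_comp (hcomp ▸ hf), fun x => ?_, hcomp⟩
  obtain ⟨v, hv⟩ := hrange.le ⟨x, rfl⟩
  exact ⟨v, he.injective ((hf' v).trans hv)⟩

end LGraph.IsSkewFibration

end DerRange

/-- An isomorphism of arenas that is witnessed, in both directions and for both parities, by
derivations: the semantic counterpart of formula isomorphism. -/
structure IsDerIso {α : Type*} (A B : Formula α) (e : A.arena.V ≃ B.arena.V) : Prop where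
  isIso : IsIso e
  der : ∀ p, Der p A B e
  der_symm : ∀ p, Der p B A e.symm

namespace IsDerIso

variable {α : Type*} {A A' B B' C : Formula α}

theorem refl (A : Formula α) : IsDerIso A A (Equiv.refl _) :=
  ⟨.refl _, fun p => .refl p A, fun p => .refl p A⟩

theorem symm {e : A.arena.V ≃ B.arena.V} (h : IsDerIso A B e) : IsDerIso B A e.symm :=
  ⟨h.isIso.symm, h.der_symm, h.der⟩

theorem trans {e : A.arena.V ≃ B.arena.V} {f : B.arena.V ≃ C.arena.V} (he : IsDerIso A B e)
    (hf : IsDerIso B C f) : IsDerIso A C (e.trans f) where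
  isIso := hf.isIso.comp he.isIso
  der p := (he.der p).comp (hf.der p)
  der_symm p := (hf.der_symm p).comp (he.der_symm p)

theorem and {e : A.arena.V ≃ A'.arena.V} {f : B.arena.V ≃ B'.arena.V} (he : IsDerIso A A' e)
    (hf : IsDerIso B B' f) : IsDerIso (A.and B) (A'.and B') (e.sumCongr f) where
  isIso := (he.isIso.isFullEmb.sumMap hf.isIso.isFullEmb).isIso (e.sumCongr f).surjective
  der p := .and (he.der p) (hf.der p)
  der_symm p := .and (he.der_symm p) (hf.der_symm p)

theorem imp {e : A.arena.V ≃ A'.arena.V} {f : B.arena.V ≃ B'.arena.V} (he : IsDerIso A A' e)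
    (hf : IsDerIso B B' f) : IsDerIso (A.imp B) (A'.imp B') (e.sumCongr f) where
  isIso := (he.isIso.isFullEmb.arrowMap hf.isIso.isFullEmb).isIso (e.sumCongr f).surjective
  der p := .imp (he.der _) (hf.der p)
  der_symm p := .imp (he.der_symm _) (hf.der_symm p)

theorem comm (A B : Formula α) : IsDerIso (A.and B) (B.and A) (andComm A B) :=
  ⟨isIso_andComm A B, fun p => .comm p A B, fun p => .comm p B A⟩

theorem assoc (A B C : Formula α) :
    IsDerIso ((A.and B).and C) (A.and (B.and C)) (andAssoc A B C) :=
  ⟨isIso_andAssoc A B C, fun p => .assoc p A B C, fun p => .assocSymm p A B C⟩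

theorem curry (A B C : Formula α) :
    IsDerIso (.imp (A.and B) C) (A.imp (B.imp C)) (impCurry A B C) :=
  ⟨isIso_impCurry A B C, fun p => .curry p A B C, fun p => .currySymm p A B C⟩

variable {p : Polarity} {F' F : Formula α} {f : F'.arena.V → F.arena.V}

theorem der_of_comp {e : A.arena.V ≃ F'.arena.V} (he : IsDerIso A F' e)
    (h : Der p A F (f ∘ e)) : Der p F' F f := by
  have := (he.der_symm p).comp h
  rwa [Function.comp_assoc, Equiv.self_comp_symm, Function.comp_id] at this

theorem der_of_symm_comp {e : A.arena.V ≃ F.arena.V} (he : IsDerIso A F e)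
    (h : Der p F' A (e.symm ∘ f)) : Der p F' F f := by
  have := h.comp (he.der p)
  rwa [← Function.comp_assoc, Equiv.self_comp_symm, Function.id_comp] at this

theorem isSkewFibration_symm_comp {e : A.arena.V ≃ F.arena.V} (he : IsDerIso A F e)
    (hf : IsSkewFibration p f) : IsSkewFibration p (e.symm ∘ f) := by
  refine he.isIso.isFullEmb.isSkewFibration_of_comp ?_
  rwa [← Function.comp_assoc, Equiv.self_comp_symm, Function.id_comp]

end IsDerIso

namespace LGraph

/-- A set of vertices that is a union of connected components, where both kinds of edges
connect. -/
structure IsEdgeClosed {α : Type*} (G : LGraph α) (S : Set G.V) : Prop where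
  mem_iff_of_iedge : ∀ v w, G.iedge v w → (v ∈ S ↔ w ∈ S)
  mem_iff_of_medge : ∀ v w, G.medge v w → (v ∈ S ↔ w ∈ S)

/-- Connectedness of a graph, where both kinds of edges connect. -/
def IsConnected {α : Type*} (G : LGraph α) : Prop :=
  ∀ S, G.IsEdgeClosed S → S = Set.univ ∨ S = ∅

section Connected

variable {α : Type*} {G H : LGraph α}

namespace IsEdgeClosed

theorem preimage {S : Set G.V} (hS : G.IsEdgeClosed S) {f : H.V → G.V}
    (hiedge : ∀ v w, H.iedge v w → G.iedge (f v) (f w))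
    (hmedge : ∀ v w, H.medge v w → G.medge (f v) (f w)) : H.IsEdgeClosed (f ⁻¹' S) :=
  ⟨fun _ _ h => hS.mem_iff_of_iedge _ _ (hiedge _ _ h),
    fun _ _ h => hS.mem_iff_of_medge _ _ (hmedge _ _ h)⟩

theorem mem_iff_of_reach {S : Set G.V} (hS : G.IsEdgeClosed S) {v w : G.V} (h : G.Reach v w) :
    v ∈ S ↔ w ∈ S := by
  induction h with
  | refl => exact .rfl
  | tail _ h ih => exact ih.trans (hS.mem_iff_of_iedge _ _ h)

theorem eq_univ_or_eq_empty [G.Graded] {S : Set G.V} (hS : G.IsEdgeClosed S) (v₀ : G.V)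
    (h : ∀ r, G.IsRoot r → (r ∈ S ↔ v₀ ∈ S)) : S = Set.univ ∨ S = ∅ := by
  have hmem (v : G.V) : v ∈ S ↔ v₀ ∈ S := by
    obtain ⟨r, hr, hvr⟩ := exists_reach_isRoot v
    exact (hS.mem_iff_of_reach hvr).trans (h r hr)
  by_cases hv₀ : v₀ ∈ S
  · exact .inl (Set.eq_univ_of_forall fun v => (hmem v).2 hv₀)
  · exact .inr (Set.eq_empty_of_forall_notMem fun v hv => hv₀ ((hmem v).1 hv))

end IsEdgeClosed

theorem isEdgeClosed_range_inl_sum : (G.sum H).IsEdgeClosed (Set.range Sum.inl) := by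
  constructor
  all_goals
    rintro (v | v) (w | w) h
    exacts [iff_of_true ⟨v, rfl⟩ ⟨w, rfl⟩, h.elim, h.elim, iff_of_false nofun nofun]

theorem isConnected_single (l : Label α) : (single l).IsConnected :=
  fun _ hS => hS.eq_univ_or_eq_empty () fun _ _ => .rfl

theorem isConnected_arrow [G.Graded] [H.Graded] [Nonempty G.V] [Nonempty H.V] :
    (G.arrow H).IsConnected := by
  intro S hS
  obtain ⟨s, hs⟩ := exists_isRoot G
  refine hS.eq_univ_or_eq_empty (.inl s) ?_
  rintro (r | r) hr
  · exact (not_isRoot_arrow_inl r hr).elim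
  · exact (hS.mem_iff_of_iedge (.inl s) (.inr r) ⟨hs, isLowerEmb_arrow_inr.isRoot_iff.1 hr⟩).symm

theorem isConnected_squig_single (l : Label α) [G.Graded] : ((single l).squig G).IsConnected := by
  refine fun S hS => hS.eq_univ_or_eq_empty (.inl ()) ?_
  rintro (r | r) hr
  · exact .rfl
  · exact (hS.mem_iff_of_medge (.inl ()) (.inr r)
      ⟨fun _ => id, isFullEmb_squig_inr.isRoot_iff.1 hr⟩).symm

theorem mem_iff_of_iedge_of_rel_even [G.Graded] {S : Set G.V}
    (hS : ∀ v ∈ S, ∀ w ∉ S, G.Rel .even v w) {v w : G.V} (hvw : G.iedge v w) :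
    v ∈ S ↔ w ∈ S := by
  have hcoconnected {x y : G.V} (h : G.Reach x y) (hy : Even (G.depth y)) : x ∈ S ↔ y ∈ S := by
    have hnot : ¬ G.Rel .even x y := fun hxy => by
      rw [Rel, Conj, h.meetingDepth_eq_depth, Int.odd_coe_nat] at hxy
      exact Nat.not_odd_iff_even.2 hy hxy.2
    exact ⟨fun hx => by_contra fun hy => hnot (hS x hx y hy),
      fun hy => by_contra fun hx => hnot (rel_comm.1 (hS y hy x hx))⟩
  rcases Nat.even_or_odd (G.depth w) with hw | hw
  · exact hcoconnected (.single hvw) hw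
  · obtain ⟨u, hwu⟩ := ‹G.Graded›.isGrading_depth.exists_iedge hw.pos.ne'
    have hu : Even (G.depth u) := by
      rwa [depth_of_iedge hwu, Nat.odd_add_one, Nat.not_odd_iff_even] at hw
    exact (hcoconnected (.head hvw (.single hwu)) hu).trans (hcoconnected (.single hwu) hu).symm

end Connected

end LGraph

namespace Formula

variable {α : Type*}

/-- `F` is, up to formula isomorphism, a conjunction of a formula with vertices in `S` and a
formula with vertices outside `S`. -/
def Splits (F : Formula α) (S : Set F.arena.V) : Prop :=
  ∃ (A B : Formula α) (e : (A.and B).arena.V ≃ F.arena.V),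
    IsDerIso _ _ e ∧ (∀ x, e (.inl x) ∈ S) ∧ ∀ y, e (.inr y) ∉ S

namespace Splits

variable {A B F K : Formula α}

theorem of_compl {S : Set F.arena.V} : F.Splits Sᶜ → F.Splits S
  | ⟨A, B, _, he, hA, hB⟩ => ⟨B, A, _, (IsDerIso.comm B A).trans he, fun y => not_not.1 (hB y), hA⟩

theorem of_preimage {e : K.arena.V ≃ F.arena.V} (he : IsDerIso K F e) {S : Set F.arena.V} :
    K.Splits (e ⁻¹' S) → F.Splits S
  | ⟨A, B, _, hk, hA, hB⟩ => ⟨A, B, _, hk.trans he, hA, hB⟩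

theorem and_of_univ_of_empty {S : Set (A.and B).arena.V} (hA : Sum.inl ⁻¹' S = Set.univ)
    (hB : Sum.inr ⁻¹' S = ∅) : (A.and B).Splits S :=
  ⟨A, B, _, .refl _, fun x => hA.ge (Set.mem_univ x), fun _ hy => hB.le hy⟩

theorem and_of_univ {S : Set (A.and B).arena.V} (hA : Sum.inl ⁻¹' S = Set.univ) :
    B.Splits (Sum.inr ⁻¹' S) → (A.and B).Splits S
  | ⟨B₁, B₂, _, he, h₁, h₂⟩ => ⟨A.and B₁, B₂, _,
      (IsDerIso.assoc A B₁ B₂).trans ((IsDerIso.refl A).and he),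
      Sum.rec (fun x => hA.ge (Set.mem_univ x)) h₁, h₂⟩

theorem and_of_univ_or_empty {S : Set (A.and B).arena.V}
    (hA : Sum.inl ⁻¹' S = Set.univ ∨ Sum.inl ⁻¹' S = ∅) (hB : B.Splits (Sum.inr ⁻¹' S)) :
    (A.and B).Splits S := by
  rcases hA with hA | hA
  · exact and_of_univ hA hB
  · refine of_compl (and_of_univ ?_ (of_compl ?_))
    · exact (congrArg compl hA).trans Set.compl_empty
    · exact (compl_compl (Sum.inr ⁻¹' S)).symm ▸ hB

theorem and {S : Set (A.and B).arena.V} :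
    A.Splits (Sum.inl ⁻¹' S) → B.Splits (Sum.inr ⁻¹' S) → (A.and B).Splits S
  | ⟨A₁, A₂, _, he, h₁, h₂⟩, ⟨B₁, B₂, _, hf, k₁, k₂⟩ => by
    have hswap := (IsDerIso.assoc B₁ A₂ B₂).symm.trans
      (((IsDerIso.comm B₁ A₂).and (.refl B₂)).trans (.assoc A₂ B₁ B₂))
    have hinterchange := (IsDerIso.assoc A₁ B₁ (A₂.and B₂)).trans
      (((IsDerIso.refl A₁).and hswap).trans (IsDerIso.assoc A₁ A₂ (B₁.and B₂)).symm)
    exact ⟨A₁.and B₁, A₂.and B₂, _, hinterchange.trans (he.and hf),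
      Sum.rec h₁ k₁, Sum.rec h₂ k₂⟩

end Splits

theorem splits_of_isEdgeClosed (F : Formula α) {S : Set F.arena.V} (hS : F.arena.IsEdgeClosed S) :
    (S = Set.univ ∨ S = ∅) ∨ F.Splits S := by
  induction F with
  | atom a => exact .inl (isConnected_single _ S hS)
  | diaBot => exact .inl (isConnected_single _ S hS)
  | imp A B => exact .inl (isConnected_arrow S hS)
  | box A => exact .inl (isConnected_squig_single _ S hS)
  | dia A => exact .inl (isConnected_squig_single _ S hS)
  | and A B ihA ihB =>
    rcases ihA (hS.preimage (f := Sum.inl) (fun _ _ => id) fun _ _ => id) with hA | hA <;>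
      rcases ihB (hS.preimage (f := Sum.inr) (fun _ _ => id) fun _ _ => id) with hB | hB
    · rcases hA with hA | hA <;> rcases hB with hB | hB
      · exact .inl (.inl (Set.eq_univ_of_forall
          (Sum.rec (fun x => hA.ge (Set.mem_univ x)) fun y => hB.ge (Set.mem_univ y))))
      · exact .inr (.and_of_univ_of_empty hA hB)
      · exact .inr (.of_preimage (.comm B A) (.and_of_univ_of_empty hB hA))
      · exact .inl (.inr (Set.eq_empty_of_forall_notMem
          (Sum.rec (fun _ hx => hA.le hx) fun _ hy => hB.le hy)))
    · exact .inr (.and_of_univ_or_empty hA hB)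
    · exact .inr (.of_preimage (.comm B A) (.and_of_univ_or_empty hB hA))
    · exact .inr (hA.and hB)

theorem exists_isDerIso_imp (A C : Formula α) :
    ∃ (A' B : Formula α) (e : (A'.imp B).arena.V ≃ (A.imp C).arena.V),
      IsDerIso _ _ e ∧ ∀ X Y, B ≠ .imp X Y := by
  induction C generalizing A with
  | imp D E _ ih =>
    obtain ⟨A', B, e, he, hB⟩ := ih (A.and D)
    exact ⟨A', B, _, he.trans (.curry A D E), hB⟩
  | _ => exact ⟨A, _, _, .refl _, nofun⟩

end Formula

section SumMaps

variable {V W V' W' : Type*} {c : Prop} {R : V → V → Prop} {S : W → W → Prop}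

theorem card_lt_card_sum_left [Finite V] [Finite W] [Nonempty W] :
    Nat.card V < Nat.card (V ⊕ W) :=
  Nat.card_sum (α := V) (β := W) ▸ Nat.lt_add_of_pos_right Nat.card_pos

theorem card_lt_card_sum_right [Finite V] [Nonempty V] [Finite W] :
    Nat.card W < Nat.card (V ⊕ W) :=
  Nat.card_sum (α := V) (β := W) ▸ Nat.lt_add_of_pos_left Nat.card_pos

theorem exists_eq_sumMap {f : V ⊕ W → V' ⊕ W'} (hl : ∀ v, f (.inl v) ∈ Set.range Sum.inl)
    (hr : ∀ w, f (.inr w) ∈ Set.range Sum.inr) : ∃ f₁ f₂, f = Sum.map f₁ f₂ := by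
  choose f₁ hf₁ using hl
  choose f₂ hf₂ using hr
  exact ⟨f₁, f₂, funext (Sum.rec (fun v => (hf₁ v).symm) fun w => (hf₂ w).symm)⟩

theorem reflTransGen_joinRel [Nonempty V] [Nonempty W] (hc : c) (x y : V ⊕ W) :
    Relation.ReflTransGen (joinRel c R S) x y := by
  have v := Classical.arbitrary V
  have w := Classical.arbitrary W
  rcases x with x | x <;> rcases y with y | y
  · exact .head (show joinRel c R S (.inl x) (.inr w) from hc) (.single hc)
  · exact .single hc
  · exact .single hc
  · exact .head (show joinRel c R S (.inr x) (.inl v) from hc) (.single hc)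

theorem mem_range_inl_iff_of_joinRel (hc : ¬ c) {x y : V ⊕ W} (h : joinRel c R S x y) :
    x ∈ Set.range Sum.inl ↔ y ∈ Set.range Sum.inl := by
  rcases x with x | x <;> rcases y with y | y
  exacts [iff_of_true ⟨x, rfl⟩ ⟨y, rfl⟩, (hc h).elim, (hc h).elim, iff_of_false nofun nofun]

end SumMaps

namespace LGraph

section Coconnected

variable {α : Type*} {G H K : LGraph α}

/-- Connectedness of the graph of conjunct vertices, the arena counterpart of not being an
implication. -/
def IsCoconnected (G : LGraph α) : Prop :=
  ∀ v w, Relation.ReflTransGen (G.Rel .even) v w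

variable [G.Graded] [H.Graded]

theorem rel_even_sum_inl_inr (v : G.V) (w : H.V) : (G.sum H).Rel .even (.inl v) (.inr w) := by
  rw [rel_sum]
  rfl

theorem rel_odd_arrow_inl_inr [Nonempty H.V] (v : G.V) (w : H.V) :
    (G.arrow H).Rel .odd (.inl v) (.inr w) := by
  rw [rel_arrow]
  rfl

theorem isCoconnected_sum [Nonempty G.V] [Nonempty H.V] : (G.sum H).IsCoconnected := by
  rw [IsCoconnected, rel_sum]
  exact reflTransGen_joinRel rfl

theorem isCoconnected_squig [Nonempty G.V] [Nonempty H.V] : (G.squig H).IsCoconnected := by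
  rw [IsCoconnected, rel_squig]
  exact reflTransGen_joinRel rfl

theorem IsCoconnected.mem_range_inl_iff [Nonempty H.V] (hK : K.IsCoconnected)
    {f : K.V → (G.arrow H).V} (hf : ∀ v w, K.Rel .even v w → (G.arrow H).Rel .even (f v) (f w))
    (v w : K.V) : f v ∈ Set.range Sum.inl ↔ f w ∈ Set.range Sum.inl := by
  rw [rel_arrow] at hf
  induction hK v w with
  | refl => rfl
  | tail _ h ih => exact ih.trans (mem_range_inl_iff_of_joinRel nofun (hf _ _ h))

end Coconnected

section Squig

variable {α : Type*} {G H : LGraph α} {k l : Label α}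

theorem not_iedge_squig_single_inl {v : Unit ⊕ G.V} (u : Unit) :
    ¬ ((single l).squig G).iedge v (.inl u) := by
  rcases v with v | v <;> exact id

theorem not_medge_squig_single_inl {v : Unit ⊕ G.V} (u : Unit) :
    ¬ ((single l).squig G).medge v (.inl u) := by
  rcases v with v | v <;> exact id

theorem isRoot_squig_single_inl (u : Unit) : ((single l).squig G).IsRoot (.inl u) := by
  rintro (v | v) h <;> exact h.elim

theorem not_rel_odd_squig_single_inl [G.Graded] (u : Unit) (v : Unit ⊕ G.V) :
    ¬ ((single l).squig G).Rel .odd (.inl u) v := by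
  rcases v with v | v
  · exact fun h => h.ne rfl
  · rw [rel_squig]
    exact nofun

variable [G.Graded] [H.Graded]

theorem IsModalHom.exists_eq_squigMap {f : ((single k).squig H).V → ((single l).squig G).V}
    (hf : IsModalHom f) (hsurj : Function.Surjective f) :
    ∃ g : H.V → G.V, f = squigMap (H₁ := single k) (G₁ := single l) id g := by
  have hinr : ∀ v, f (.inr v) ∈ Set.range Sum.inr := by
    intro v
    rcases hv : f (.inr v) with u | y
    · have hroot : H.IsRoot v := isFullEmb_squig_inr.isRoot_iff.1
        (hf.isRoot_iff.1 (hv ▸ isRoot_squig_single_inl u))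
      have hmedge := hf.medge (.inl ()) (.inr v) ⟨fun _ => id, hroot⟩
      exact (not_medge_squig_single_inl u (hv ▸ hmedge)).elim
    · exact ⟨y, rfl⟩
  have hinl : ∀ u, f (.inl u) ∈ Set.range Sum.inl := by
    intro u
    obtain ⟨v | v, hv⟩ := hsurj (.inl ())
    · exact ⟨(), hv.symm⟩
    · obtain ⟨y, hy⟩ := hinr v
      cases hy.trans hv
  obtain ⟨_, g, rfl⟩ := exists_eq_sumMap hinl hinr
  exact ⟨g, rfl⟩

/- A root `b` of `H` would lie under a modality in its own summand with the same image as `v`. -/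
theorem IsSkewFibration.inl_ne_inl_of_sum {K : LGraph α} [K.Graded] [Nonempty H.V]
    {f : (K.sum H).V → ((single l).squig G).V} (hf : IsSkewFibration .even f) (v : K.V) :
    f (.inl v) ≠ .inl () := by
  intro hv
  have hne (w : H.V) : f (.inl v) ≠ f (.inr w) :=
    (hf.preserves _ _ (rel_even_sum_inl_inr v w)).ne
  obtain ⟨b, hb⟩ := exists_isRoot H
  have hroot : ((single l).squig G).IsRoot (f (.inr b)) :=
    hf.isRoot_iff.2 (isLowerEmb_sum_inr.isRoot_iff.2 hb)
  have hmedge : ((single l).squig G).medge (.inl ()) (f (.inr b)) := by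
    rcases hfb : f (.inr b) with u | y
    · exact (hne b (hv.trans hfb.symm)).elim
    · exact ⟨fun _ => id, isFullEmb_squig_inr.isRoot_iff.1 (hfb ▸ hroot)⟩
  obtain ⟨w | w, hwb, hw⟩ := hf.modal _ _ hmedge
  · exact hwb
  · exact hne w (hv.trans hw.symm)

end Squig

section Arrow

variable {α : Type*} {G H K : LGraph α}

theorem mem_range_inl_iff_of_iedge_arrow {x y : G.V ⊕ H.V} (h : (G.arrow H).iedge x y)
    (hy : ¬ (G.arrow H).IsRoot y) : x ∈ Set.range Sum.inl ↔ y ∈ Set.range Sum.inl := by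
  rcases x with x | x <;> rcases y with y | y
  exacts [iff_of_true ⟨x, rfl⟩ ⟨y, rfl⟩, (hy (isLowerEmb_arrow_inr.isRoot_iff.2 h.2)).elim,
    h.elim, iff_of_false nofun nofun]

theorem mem_range_inl_iff_of_medge_arrow {x y : G.V ⊕ H.V} (h : (G.arrow H).medge x y) :
    x ∈ Set.range Sum.inl ↔ y ∈ Set.range Sum.inl := by
  rcases x with x | x <;> rcases y with y | y
  exacts [iff_of_true ⟨x, rfl⟩ ⟨y, rfl⟩, h.elim, h.elim, iff_of_false nofun nofun]

variable {A B : LGraph α} [A.Graded] [B.Graded] [Nonempty B.V]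

theorem IsSkewFibration.rel_odd_of_arrow {f : (A.arrow B).V → G.V} (hf : IsSkewFibration .odd f)
    (a : A.V) (b : B.V) : G.Rel .odd (f (.inl a)) (f (.inr b)) :=
  hf.preserves _ _ (rel_odd_arrow_inl_inr a b)

variable {f : (A.arrow B).V → (G.arrow H).V}

theorem IsSkewFibration.notMem_preimage_range_of_inr (hf : IsSkewFibration .odd f) {b : B.V}
    {x : G.V} (hb : f (.inr b) = .inl x) : x ∉ Sum.inl ⁻¹' Set.range (f ∘ Sum.inl) := by
  rintro ⟨a, ha⟩
  exact (hf.rel_odd_of_arrow a b).ne (ha.trans hb.symm)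

variable [G.Graded] [H.Graded] [K.Graded] [Nonempty H.V]

theorem IsModalHom.notMem_range_inl_of_isRoot {f : K.V → (G.arrow H).V} (hf : IsModalHom f)
    {v : K.V} (hv : K.IsRoot v) : f v ∉ Set.range Sum.inl := by
  rintro ⟨x, hx⟩
  exact not_isRoot_arrow_inl (H := H) x (hx ▸ hf.isRoot_iff.2 hv)

theorem IsModalHom.isEdgeClosed_preimage_range_inl (hf : IsModalHom f) :
    A.IsEdgeClosed ((f ∘ Sum.inl) ⁻¹' Set.range Sum.inl) where
  mem_iff_of_iedge v w h := mem_range_inl_iff_of_iedge_arrow (hf.iedge (.inl v) (.inl w) h)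
    fun hw => not_isRoot_arrow_inl w (hf.isRoot_iff.1 hw)
  mem_iff_of_medge v w h := mem_range_inl_iff_of_medge_arrow (hf.medge (.inl v) (.inl w) h)

theorem IsSkewFibration.isEdgeClosed_preimage_range (hf : IsSkewFibration .odd f)
    (hsurj : Function.Surjective f) :
    G.IsEdgeClosed (Sum.inl ⁻¹' Set.range (f ∘ Sum.inl)) := by
  have hinr : ∀ x ∉ Sum.inl ⁻¹' Set.range (f ∘ Sum.inl), ∃ b, f (.inr b) = .inl x := by
    intro x hx
    obtain ⟨v | v, hv⟩ := hsurj (.inl x)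
    · exact (hx ⟨v, hv⟩).elim
    · exact ⟨v, hv⟩
  refine ⟨fun _ _ => mem_iff_of_iedge_of_rel_even ?_, fun v w h => ⟨?_, ?_⟩⟩
  · rintro v ⟨a, ha⟩ w hw
    obtain ⟨b, hb⟩ := hinr w hw
    have hab := hf.rel_odd_of_arrow a b
    rwa [show f (.inl a) = .inl v from ha, hb, rel_arrow] at hab
  · intro hv
    by_contra hw
    obtain ⟨b, hb⟩ := hinr w hw
    obtain ⟨u | u, hub, hu⟩ := hf.modal (.inl v) (.inr b) (hb ▸ h)
    · exact hub
    · exact hf.notMem_preimage_range_of_inr hu hv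
  · rintro ⟨a, ha⟩
    obtain ⟨u | u, hua, hu⟩ := hf.modal (.inl v) (.inl a)
      ((show f (.inl a) = .inl w from ha) ▸ h)
    · exact ⟨u, hu⟩
    · exact hua.elim

end Arrow

end LGraph

namespace Formula

variable {α : Type*} {A B F : Formula α}

instance finite_arena (F : Formula α) : Finite F.arena.V := by
  induction F with
  | atom a => exact inferInstanceAs (Finite Unit)
  | diaBot => exact inferInstanceAs (Finite Unit)
  | imp A B _ _ => exact inferInstanceAs (Finite (A.arena.V ⊕ B.arena.V))
  | and A B _ _ => exact inferInstanceAs (Finite (A.arena.V ⊕ B.arena.V))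
  | box A _ => exact inferInstanceAs (Finite (Unit ⊕ A.arena.V))
  | dia A _ => exact inferInstanceAs (Finite (Unit ⊕ A.arena.V))

theorem isCoconnected_of_ne_imp (hF : ∀ A B, F ≠ .imp A B) : F.arena.IsCoconnected := by
  cases F with
  | atom a => exact fun _ _ => .refl
  | diaBot => exact fun _ _ => .refl
  | imp A B => exact (hF A B rfl).elim
  | and A B => exact isCoconnected_sum
  | box A => exact isCoconnected_squig (G := single .box)
  | dia A => exact isCoconnected_squig (G := single .dia)

theorem exists_forall_not_rel_odd (himp : ∀ A B, F ≠ .imp A B) (hand : ∀ A B, F ≠ .and A B) :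
    ∃ v, ∀ w, ¬ F.arena.Rel .odd v w := by
  cases F with
  | atom a => exact ⟨(), fun _ h => h.ne rfl⟩
  | diaBot => exact ⟨(), fun _ h => h.ne rfl⟩
  | imp A B => exact (himp A B rfl).elim
  | and A B => exact (hand A B rfl).elim
  | box A => exact ⟨.inl (), not_rel_odd_squig_single_inl ()⟩
  | dia A => exact ⟨.inl (), not_rel_odd_squig_single_inl ()⟩

theorem exists_isRoot_not_rel_odd (hF : ∀ A B, F ≠ .imp A B) (v : F.arena.V) :
    ∃ r, F.arena.IsRoot r ∧ ¬ F.arena.Rel .odd v r := by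
  cases F with
  | atom a => exact ⟨(), fun _ => id, fun h => h.ne rfl⟩
  | diaBot => exact ⟨(), fun _ => id, fun h => h.ne rfl⟩
  | imp A B => exact (hF A B rfl).elim
  | and A B =>
    have hrel := rel_sum A.arena B.arena .odd
    rcases v with v | v
    · obtain ⟨r, hr⟩ := exists_isRoot B.arena
      exact ⟨.inr r, isLowerEmb_sum_inr.isRoot_iff.2 hr,
        fun h => nomatch congrFun₂ hrel (.inl v) (.inr r) ▸ h⟩
    · obtain ⟨r, hr⟩ := exists_isRoot A.arena
      exact ⟨.inl r, isLowerEmb_sum_inl.isRoot_iff.2 hr,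
        fun h => nomatch congrFun₂ hrel (.inr v) (.inl r) ▸ h⟩
  | box A =>
    exact ⟨.inl (), isRoot_squig_single_inl _, fun h =>
      not_rel_odd_squig_single_inl _ _ (rel_comm.1 h)⟩
  | dia A =>
    exact ⟨.inl (), isRoot_squig_single_inl _, fun h =>
      not_rel_odd_squig_single_inl _ _ (rel_comm.1 h)⟩

end Formula

namespace LGraph.IsSkewFibration

variable {α : Type*} {p : Polarity} {F' X Y : Formula α}

theorem eq_of_single {l : Label α} {f : F'.arena.V → (single l).V} (hf : IsSkewFibration p f)
    (hp : p = .odd → ∀ A B, F' ≠ .and A B) :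
    (∃ a, F' = .atom a ∧ l = .atom a) ∨ (F' = .diaBot ∧ l = .dia) := by
  cases F' with
  | atom a => exact .inl ⟨a, rfl, (hf.lab ()).symm⟩
  | diaBot => exact .inr ⟨rfl, (hf.lab ()).symm⟩
  | and A B =>
    cases p with
    | odd => exact (hp rfl A B rfl).elim
    | even =>
      have a := Classical.arbitrary A.arena.V
      have b := Classical.arbitrary B.arena.V
      exact ((hf.preserves _ _ (rel_even_sum_inl_inr a b)).ne rfl).elim
  | imp A B =>
    obtain ⟨a, ha⟩ := exists_isRoot A.arena
    obtain ⟨b, hb⟩ := exists_isRoot B.arena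
    exact (hf.iedge (.inl a) (.inr b) ⟨ha, hb⟩).elim
  | box A =>
    obtain ⟨a, ha⟩ := exists_isRoot A.arena
    exact (hf.medge (.inl ()) (.inr a) ⟨fun _ => id, ha⟩).elim
  | dia A =>
    obtain ⟨a, ha⟩ := exists_isRoot A.arena
    exact (hf.medge (.inl ()) (.inr a) ⟨fun _ => id, ha⟩).elim

theorem exists_eq_box_or_dia {G : LGraph α} [G.Graded] [Nonempty G.V] {l : Label α}
    {f : F'.arena.V → ((single l).squig G).V} (hf : IsSkewFibration p f)
    (hp : p = .odd → ∀ A B, F' ≠ .and A B) (hsurj : Function.Surjective f) :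
    ∃ A, F' = .box A ∨ F' = .dia A := by
  have hnontrivial : ∃ v w, f v ≠ f w := by
    obtain ⟨v, hv⟩ := hsurj (.inl ())
    obtain ⟨w, hw⟩ := hsurj (.inr (Classical.arbitrary G.V))
    exact ⟨v, w, by rw [hv, hw]; exact Sum.inl_ne_inr⟩
  obtain ⟨v, hv⟩ := hsurj (.inl ())
  cases F' with
  | atom a => exact hnontrivial.elim fun _ ⟨_, h⟩ => (h rfl).elim
  | diaBot => exact hnontrivial.elim fun _ ⟨_, h⟩ => (h rfl).elim
  | box A => exact ⟨A, .inl rfl⟩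
  | dia A => exact ⟨A, .inr rfl⟩
  | imp A B =>
    have hroot : (A.arena.arrow B.arena).IsRoot v :=
      hf.isRoot_iff.1 (hv ▸ isRoot_squig_single_inl ())
    rcases v with v | v
    · exact (not_isRoot_arrow_inl v hroot).elim
    · obtain ⟨a, ha⟩ := exists_isRoot A.arena
      have hiedge := hf.iedge (.inl a) (.inr v) ⟨ha, isLowerEmb_arrow_inr.isRoot_iff.1 hroot⟩
      exact (not_iedge_squig_single_inl () (hv ▸ hiedge)).elim
  | and A B =>
    cases p with
    | odd => exact (hp rfl A B rfl).elim
    | even =>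
      rcases v with v | v
      · exact (hf.inl_ne_inl_of_sum v hv).elim
      · exact ((hf.comp_isIso (isIso_andComm B A)).inl_ne_inl_of_sum v hv).elim

theorem exists_eq_imp {f : F'.arena.V → (X.imp Y).arena.V} (hf : IsSkewFibration p f)
    (hp : p = .odd → ∀ A B, F' ≠ .and A B) (hsurj : Function.Surjective f) :
    ∃ A B, F' = .imp A B := by
  by_contra! hF
  have x := Classical.arbitrary X.arena.V
  have y := Classical.arbitrary Y.arena.V
  cases p with
  | even =>
    obtain ⟨v, hv⟩ := hsurj (.inl x)
    obtain ⟨w, hw⟩ := hsurj (.inr y)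
    obtain ⟨z, hz⟩ := ((isCoconnected_of_ne_imp hF).mem_range_inl_iff hf.preserves v w).1
      ⟨x, hv.symm⟩
    cases hz.trans hw
  | odd =>
    obtain ⟨v, hv⟩ := exists_forall_not_rel_odd hF (hp rfl)
    obtain ⟨w, hw⟩ : ∃ w, (X.imp Y).arena.Rel .odd (f v) w := by
      rcases f v with a | a
      · exact ⟨.inr y, rel_odd_arrow_inl_inr a y⟩
      · exact ⟨.inl x, rel_comm.1 (rel_odd_arrow_inl_inr x a)⟩
    obtain ⟨u, hu, -⟩ := hf.lifting v w hw
    exact hv u hu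

end LGraph.IsSkewFibration

/-- All skew fibrations from arenas with fewer vertices than the arena of `F'` are witnessed by
derivations: the induction hypothesis of the decomposition. -/
def DerBelow {α : Type*} (F' : Formula α) : Prop :=
  ∀ (p : Polarity) (K F : Formula α) (f : K.arena.V → F.arena.V),
    Nat.card K.arena.V < Nat.card F'.arena.V → IsSkewFibration p f → Der p K F f

theorem DerBelow.of_equiv {α : Type*} {A F' : Formula α} (ih : DerBelow F')
    (e : A.arena.V ≃ F'.arena.V) : DerBelow A :=
  fun p K F f h => ih p K F f (h.trans_eq (Nat.card_congr e))

namespace LGraph.IsSkewFibration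

variable {α : Type*} {p : Polarity} {F' F A B X Y : Formula α}

theorem der_of_and_source {f : (A.and B).arena.V → F.arena.V} (hf : IsSkewFibration .odd f)
    (ih : DerBelow (A.and B)) : Der .odd (A.and B) F f := by
  obtain ⟨f₁, f₂, rfl⟩ : ∃ (f₁ : A.arena.V → F.arena.V) (f₂ : B.arena.V → F.arena.V),
      f = copair f₁ f₂ := ⟨_, _, (Sum.elim_comp_inl_inr f).symm⟩
  obtain ⟨h₁, h₂⟩ := of_copair hf
  have hder := (Der.and (ih _ _ _ _ card_lt_card_sum_left h₁)
    (ih _ _ _ _ card_lt_card_sum_right h₂)).comp (.contr F)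
  exact (funext (Sum.rec (fun _ => rfl) fun _ => rfl) :
    copair id id ∘ sumMap f₁ f₂ = copair f₁ f₂) ▸ hder

theorem der_of_sumMap {f : (A.and B).arena.V → (X.and Y).arena.V} (hf : IsSkewFibration p f)
    (hl : ∀ v, f (.inl v) ∈ Set.range Sum.inl) (hr : ∀ w, f (.inr w) ∈ Set.range Sum.inr)
    (ih : DerBelow (A.and B)) : Der p (A.and B) (X.and Y) f := by
  obtain ⟨f₁, f₂, rfl⟩ : ∃ (f₁ : A.arena.V → X.arena.V) (f₂ : B.arena.V → Y.arena.V),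
      f = sumMap f₁ f₂ := exists_eq_sumMap hl hr
  obtain ⟨h₁, h₂⟩ := of_sumMap hf
  exact .and (ih _ _ _ _ card_lt_card_sum_left h₁) (ih _ _ _ _ card_lt_card_sum_right h₂)

theorem der_of_arrowMap {f : (A.imp B).arena.V → (X.imp Y).arena.V} (hf : IsSkewFibration p f)
    (hl : ∀ v, f (.inl v) ∈ Set.range Sum.inl) (hr : ∀ w, f (.inr w) ∈ Set.range Sum.inr)
    (ih : DerBelow (A.imp B)) : Der p (A.imp B) (X.imp Y) f := by
  obtain ⟨f₁, f₂, rfl⟩ : ∃ (f₁ : A.arena.V → X.arena.V) (f₂ : B.arena.V → Y.arena.V),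
      f = arrowMap f₁ f₂ := exists_eq_sumMap hl hr
  obtain ⟨h₁, h₂⟩ := of_arrowMap hf
  exact .imp (ih _ _ _ _ card_lt_card_sum_left h₁) (ih _ _ _ _ card_lt_card_sum_right h₂)

theorem der_of_and {f : F'.arena.V → (X.and Y).arena.V} (hf : IsSkewFibration p f)
    (hsurj : Function.Surjective f) (ih : DerBelow F') : Der p F' (X.and Y) f := by
  obtain ⟨v, hv⟩ := hsurj (.inl (Classical.arbitrary X.arena.V))
  obtain ⟨w, hw⟩ := hsurj (.inr (Classical.arbitrary Y.arena.V))
  rcases F'.splits_of_isEdgeClosed (isEdgeClosed_range_inl_sum.preimage hf.iedge hf.medge) with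
    (h | h) | ⟨A, B, e, he, h₁, h₂⟩
  · obtain ⟨z, hz⟩ := h.ge (Set.mem_univ w)
    cases hz.trans hw
  · exact (h.le (⟨_, hv.symm⟩ : f v ∈ Set.range Sum.inl)).elim
  · exact he.der_of_comp ((hf.comp_isIso he.isIso).der_of_sumMap h₁
      (fun y => Set.compl_range_inl.le (h₂ y)) (ih.of_equiv e))

theorem inr_mem_range_inr_of_even (hB : ∀ C D, B ≠ .imp C D)
    {f : (A.imp B).arena.V → (X.imp Y).arena.V} (hf : IsSkewFibration .even f) (b : B.arena.V) :
    f (.inr b) ∈ Set.range Sum.inr := by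
  obtain ⟨r, hr⟩ := exists_isRoot B.arena
  have hfr : f (.inr r) ∉ Set.range Sum.inl :=
    hf.notMem_range_inl_of_isRoot (isLowerEmb_arrow_inr.isRoot_iff.2 hr)
  have hpreserves : ∀ v w, B.arena.Rel .even v w →
      (X.imp Y).arena.Rel .even (f (.inr v)) (f (.inr w)) :=
    fun v w h => hf.preserves _ _ (isLowerEmb_arrow_inr.rel_iff.2 h)
  exact Set.compl_range_inl.le fun hb =>
    hfr (((isCoconnected_of_ne_imp hB).mem_range_inl_iff hpreserves b r).1 hb)

theorem der_of_even_imp (hB : ∀ C D, B ≠ .imp C D)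
    {f : (A.imp B).arena.V → (X.imp Y).arena.V} (hf : IsSkewFibration .even f)
    (hsurj : Function.Surjective f) (ih : DerBelow (A.imp B)) :
    Der .even (A.imp B) (X.imp Y) f := by
  have hinr := inr_mem_range_inr_of_even hB hf
  rcases A.splits_of_isEdgeClosed hf.isEdgeClosed_preimage_range_inl with
    (h | h) | ⟨A₁, A₂, e, he, h₁, h₂⟩
  · exact hf.der_of_arrowMap (fun a => h.ge (Set.mem_univ a)) hinr ih
  · obtain ⟨v | v, hv⟩ := hsurj (.inl (Classical.arbitrary X.arena.V))
    · exact (h.le (⟨_, hv.symm⟩ : f (.inl v) ∈ Set.range Sum.inl)).elim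
    · obtain ⟨y, hy⟩ := hinr v
      cases hy.trans hv
  · have hcurry := (IsDerIso.curry A₁ A₂ B).symm.trans (he.imp (.refl B))
    exact hcurry.der_of_comp ((hf.comp_isIso hcurry.isIso).der_of_arrowMap h₁
      (Sum.rec (fun v => Set.compl_range_inl.le (h₂ v)) hinr)
      (ih.of_equiv ((impCurry A₁ A₂ B).symm.trans (e.sumCongr (.refl _)))))

theorem inl_mem_range_inl_of_odd (hY : ∀ C D, Y ≠ .imp C D)
    {f : (A.imp B).arena.V → (X.imp Y).arena.V} (hf : IsSkewFibration .odd f)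
    (hsurj : Function.Surjective f) (a : A.arena.V) : f (.inl a) ∈ Set.range Sum.inl := by
  rcases ha : f (.inl a) with x | y
  · exact ⟨x, rfl⟩
  · obtain ⟨r, hr, hyr⟩ := exists_isRoot_not_rel_odd hY y
    obtain ⟨v | v, hv⟩ := hsurj (.inr r)
    · have hroot := hf.isRoot_iff.1 (hv ▸ isLowerEmb_arrow_inr.isRoot_iff.2 hr)
      exact (not_isRoot_arrow_inl v hroot).elim
    · have hrel := hf.rel_odd_of_arrow a v
      rw [ha, hv] at hrel
      exact (hyr (isLowerEmb_arrow_inr.rel_iff.1 hrel)).elim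

theorem der_of_odd_imp (hY : ∀ C D, Y ≠ .imp C D)
    {f : (A.imp B).arena.V → (X.imp Y).arena.V} (hf : IsSkewFibration .odd f)
    (hsurj : Function.Surjective f) (ih : DerBelow (A.imp B)) :
    Der .odd (A.imp B) (X.imp Y) f := by
  have hinl := inl_mem_range_inl_of_odd hY hf hsurj
  rcases X.splits_of_isEdgeClosed (hf.isEdgeClosed_preimage_range hsurj) with
    (h | h) | ⟨X₁, X₂, e, he, h₁, h₂⟩
  · refine hf.der_of_arrowMap hinl (fun b => Set.compl_range_inl.le ?_) ih
    rintro ⟨x, hx⟩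
    exact hf.notMem_preimage_range_of_inr hx.symm (h.ge (Set.mem_univ x))
  · have a := Classical.arbitrary A.arena.V
    obtain ⟨x, hx⟩ := hinl a
    exact (h.le (⟨a, hx.symm⟩ : x ∈ Sum.inl ⁻¹' Set.range (f ∘ Sum.inl))).elim
  · have hcurry := (IsDerIso.curry X₁ X₂ Y).symm.trans (he.imp (.refl Y))
    refine hcurry.der_of_symm_comp ((hcurry.isSkewFibration_symm_comp hf).der_of_arrowMap ?_ ?_ ih)
    · intro a
      obtain ⟨x, hx⟩ := hinl a
      obtain ⟨z | z, rfl⟩ := e.surjective x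
      · exact ⟨z, (Equiv.eq_symm_apply _).2 hx⟩
      · exact (h₂ z ⟨a, hx.symm⟩).elim
    · intro b
      rcases hb : f (.inr b) with x | y
      · obtain ⟨z | z, rfl⟩ := e.surjective x
        · exact (hf.notMem_preimage_range_of_inr hb (h₁ z)).elim
        · exact ⟨.inl z, (Equiv.eq_symm_apply _).2 hb.symm⟩
      · exact ⟨.inr y, (Equiv.eq_symm_apply _).2 hb.symm⟩

theorem der_of_imp {f : F'.arena.V → (X.imp Y).arena.V} (hf : IsSkewFibration p f)
    (hp : p = .odd → ∀ A B, F' ≠ .and A B) (hsurj : Function.Surjective f)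
    (ih : DerBelow F') : Der p F' (X.imp Y) f := by
  obtain ⟨A, C, rfl⟩ := hf.exists_eq_imp hp hsurj
  cases p with
  | even =>
    obtain ⟨A', B, e, he, hB⟩ := exists_isDerIso_imp A C
    exact he.der_of_comp (der_of_even_imp hB (hf.comp_isIso he.isIso)
      (hsurj.comp e.surjective) (ih.of_equiv e))
  | odd =>
    obtain ⟨X', Y', e, he, hY⟩ := exists_isDerIso_imp X Y
    exact he.der_of_symm_comp (der_of_odd_imp hY (he.isSkewFibration_symm_comp hf)
      (e.symm.surjective.comp hsurj) ih)

theorem der_of_surjective {f : F'.arena.V → F.arena.V} (hf : IsSkewFibration p f)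
    (hsurj : Function.Surjective f) (ih : DerBelow F') : Der p F' F f := by
  by_cases hp : p = .odd ∧ ∃ A B, F' = .and A B
  · obtain ⟨rfl, A, B, rfl⟩ := hp
    exact hf.der_of_and_source ih
  replace hp : p = .odd → ∀ A B, F' ≠ .and A B := fun h A B hF => hp ⟨h, A, B, hF⟩
  cases F with
  | atom a =>
    obtain ⟨_, rfl, ⟨⟩⟩ | ⟨_, ⟨⟩⟩ := eq_of_single hf hp
    exact .refl _ _
  | diaBot =>
    obtain ⟨_, _, ⟨⟩⟩ | ⟨rfl, _⟩ := eq_of_single hf hp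
    exact .refl _ _
  | and X Y => exact hf.der_of_and hsurj ih
  | imp X Y => exact hf.der_of_imp hp hsurj ih
  | box X =>
    obtain ⟨A, rfl | rfl⟩ := exists_eq_box_or_dia hf hp hsurj
    · obtain ⟨g, rfl⟩ := IsModalHom.exists_eq_squigMap hf.toIsModalHom hsurj
      exact .box (ih _ _ _ _ (card_lt_card_sum_right (V := Unit)) (of_squigMap hf))
    · obtain ⟨g, rfl⟩ := IsModalHom.exists_eq_squigMap hf.toIsModalHom hsurj
      cases hf.lab (.inl ())
  | dia X =>
    obtain ⟨A, rfl | rfl⟩ := exists_eq_box_or_dia hf hp hsurj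
    · obtain ⟨g, rfl⟩ := IsModalHom.exists_eq_squigMap hf.toIsModalHom hsurj
      cases hf.lab (.inl ())
    · obtain ⟨g, rfl⟩ := IsModalHom.exists_eq_squigMap hf.toIsModalHom hsurj
      exact .dia (ih _ _ _ _ (card_lt_card_sum_right (V := Unit)) (of_squigMap hf))

theorem der {f : F'.arena.V → F.arena.V} (hf : IsSkewFibration p f) : Der p F' F f := by
  induction h : Nat.card F'.arena.V using Nat.strong_induction_on generalizing p F' F with
  | h n ih =>
    obtain ⟨K, f', g, hg, hf', hsurj, rfl⟩ := hf.exists_surjective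
    exact (hf'.der_of_surjective hsurj fun q A B k hA hk => ih _ (h ▸ hA) hk rfl).comp hg

end LGraph.IsSkewFibration

theorem mainTheorem7 {α : Type*} :
    (∀ (p : Polarity) (H' H : PFormula α p),
      PFormula.Derives H' H ↔ ∃ f : H'.arena.V → H.arena.V, LGraph.IsSkewFibration p f) ∧
    (∀ (p : Polarity) (F' F : Formula α) (f : F'.arena.V → F.arena.V),
      LGraph.IsSkewFibration p f → LGraph.Built p f) := by
  refine ⟨fun p H' H => ⟨fun h => ?_, ?_⟩, fun p F' F f hf => hf.der.built⟩
  · obtain ⟨f, hf⟩ := h.exists_der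
    exact ⟨f, hf.isCliqueMap.isSkewFibration⟩
  · rintro ⟨f, hf⟩
    exact .of_der hf.der
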